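/- Edge-ordered graphs are finite simple graphs together with a total order of the edge set. An embedding of an edge-ordered graph $F$ into an edge-ordered graph $H$ is an injective map $\varphi:V(F)\to V(H)$ that maps edges to edges and satisfies $\varphi(u)\varphi(v)<\varphi(w)\varphi(z)$ whenever $uv<wz$ in $F$; its image is a copy of $F$ in $H$. Call $F$ *Turánable* if there is a positive integer $t$ such that every edge-ordering of $K_t$ contains a copy of $F$. Call $F$ *tileable* if there is a positive integer $t$ divisible by $|V(F)|$ such that every edge-ordering of $K_t$ contains a perfect $F$-tiling, i.e. a collection of vertex-disjoint copies of $F$ that covers all vertices of $K_t$. On the vertex set $\{v_1,\dots,v_n\}$ of $K_n$, the *min ordering* is the edge-ordering in which $v_iv_j$ ($i<j$) has label $2ni+j-1$, and the *max ordering* is the one in which $v_iv_j$ ($i<j$) has label $(2n-1)j+i$; edges are ordered by increasing label. Let $f=|V(F)|$. A vertex of $F$ is *minimal* if some embedding of $F$ into the min ordering of $K_f$ maps it to $v_1$, and *maximal* if some embedding of $F$ into the max ordering of $K_f$ maps it to $v_f$. **Proposition.** Let $F$ be a Turánable edge-ordered graph, and let $\underline v\neq\overline v$ be non-isolated vertices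 of $F$ such that $\underline v$ is minimal and $\overline v$ is maximal. Let $F'$ be the edge-ordered graph obtained from $F$ by adding two new vertices $\underline u,\overline u$ and the edges $\underline u\,\underline v$ and $\overline u\,\overline v$, where $\underline u\,\underline v$ is smaller than all other edges of $F'$, $\overline u\,\overline v$ is larger than all other edges of $F'$, and the edges of $F$ keep their order. Then $F'$ is tileable. -/

import Mathlib

/-- A graph on the vertex type `V` together with a total order of its edge set. -/
structure EdgeOrderedGraph (V : Type*) where
  /-- The underlying (simple, unordered) graph. -/
  graph : SimpleGraph V
  /-- The total order of the edges. -/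
  edgeOrder : LinearOrder graph.edgeSet

namespace EdgeOrderedGraph

universe u v

/-- `F.EdgeLT e e'`: the edge `e` is smaller than the edge `e'` in the edge-ordered graph `F`. -/
def EdgeLT {V : Type u} (F : EdgeOrderedGraph V) (e e' : F.graph.edgeSet) : Prop :=
  F.edgeOrder.lt e e'

/-- An embedding of the edge-ordered graph `F` into the edge-ordered graph `H`: an injective map on
the vertices which maps edges to edges and preserves the order of the edges. -/
structure Embedding {V : Type u} {W : Type v} (F : EdgeOrderedGraph V)
    (H : EdgeOrderedGraph W) where
  /-- The underlying injective graph homomorphism. -/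
  toCopy : SimpleGraph.Copy F.graph H.graph
  edgeLT_map : ∀ e e' : F.graph.edgeSet, F.EdgeLT e e' →
    H.EdgeLT (toCopy.mapEdgeSet e) (toCopy.mapEdgeSet e')

/-- The set of vertices covered by the copy of `F` given by an embedding. -/
def Embedding.vertexSet {V : Type u} {W : Type v} {F : EdgeOrderedGraph V}
    {H : EdgeOrderedGraph W} (φ : Embedding F H) : Set W :=
  Set.range (fun x : V => φ.toCopy x)

/-- `H` contains a copy of `F`. -/
def ContainsCopy {V : Type u} {W : Type v} (H : EdgeOrderedGraph W)
    (F : EdgeOrderedGraph V) : Prop :=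
  Nonempty (Embedding F H)

/-- An `F`-tiling in `H`: a collection of vertex-disjoint copies of `F` in `H`. -/
def IsTiling {V : Type u} {W : Type v} {F : EdgeOrderedGraph V} {H : EdgeOrderedGraph W}
    (T : Set (Embedding F H)) : Prop :=
  T.PairwiseDisjoint Embedding.vertexSet

/-- `H` contains a perfect `F`-tiling, that is, an `F`-tiling covering all the vertices of `H`. -/
def HasPerfectTiling {V : Type u} {W : Type v} (H : EdgeOrderedGraph W)
    (F : EdgeOrderedGraph V) : Prop :=
  ∃ T : Set (Embedding F H), IsTiling T ∧ ∀ w : W, ∃ φ ∈ T, w ∈ φ.vertexSet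

/-- The complete graph `K_t` (on the vertex set `Fin t`) with a given edge-ordering. -/
def complete (t : ℕ) (o : LinearOrder (⊤ : SimpleGraph (Fin t)).edgeSet) :
    EdgeOrderedGraph (Fin t) :=
  ⟨⊤, o⟩

/-- `F` is Turánable: for some positive `t`, every edge-ordering of `K_t` contains a copy
of `F`. -/
def Turanable {V : Type u} (F : EdgeOrderedGraph V) : Prop :=
  ∃ t : ℕ, 0 < t ∧ ∀ o : LinearOrder (⊤ : SimpleGraph (Fin t)).edgeSet,
    (complete t o).ContainsCopy F

/-- `F` is tileable: for some positive `t` divisible by the number of vertices of `F`, every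
edge-ordering of `K_t` contains a perfect `F`-tiling. -/
def Tileable {V : Type u} [Fintype V] (F : EdgeOrderedGraph V) : Prop :=
  ∃ t : ℕ, 0 < t ∧ Fintype.card V ∣ t ∧
    ∀ o : LinearOrder (⊤ : SimpleGraph (Fin t)).edgeSet, (complete t o).HasPerfectTiling F

/-! ### The min ordering and the max ordering of `K_n`

The vertices `v_1, …, v_n` of `K_n` are the elements `0, …, n - 1` of `Fin n`, in this order. For an
edge `e = v_i v_j` with `i < j` we have `i = e.inf + 1` and `j = e.sup + 1`. -/

/-- The label `2 n i + j - 1` of the edge `v_i v_j`, `i < j`. -/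
def minLabel (n : ℕ) (e : Sym2 (Fin n)) : ℤ :=
  2 * (n : ℤ) * (((e.inf : Fin n) : ℤ) + 1) + (((e.sup : Fin n) : ℤ) + 1) - 1

/-- The label `(2 n - 1) j + i` of the edge `v_i v_j`, `i < j`. -/
def maxLabel (n : ℕ) (e : Sym2 (Fin n)) : ℤ :=
  (2 * (n : ℤ) - 1) * (((e.sup : Fin n) : ℤ) + 1) + (((e.inf : Fin n) : ℤ) + 1)

theorem minLabel_injective (n : ℕ) : Function.Injective (minLabel n) := by
  intro e e' h
  unfold minLabel at h
  have h1 := e.inf.isLt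
  have h2 := e.sup.isLt
  have h3 := e'.inf.isLt
  have h4 := e'.sup.isLt
  have key : ((e.inf : Fin n) : ℤ) = ((e'.inf : Fin n) : ℤ) := by
    rcases lt_trichotomy ((e.inf : Fin n) : ℤ) ((e'.inf : Fin n) : ℤ) with hlt | heq | hlt
    · nlinarith
    · exact heq
    · nlinarith
  rw [key] at h
  refine Sym2.inf_eq_inf_and_sup_eq_sup.1 ⟨Fin.ext ?_, Fin.ext ?_⟩
  · exact_mod_cast key
  · omega

theorem maxLabel_injective (n : ℕ) : Function.Injective (maxLabel n) := by
  intro e e' h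
  unfold maxLabel at h
  have h1 := e.inf.isLt
  have h2 := e.sup.isLt
  have h3 := e'.inf.isLt
  have h4 := e'.sup.isLt
  have key : ((e.sup : Fin n) : ℤ) = ((e'.sup : Fin n) : ℤ) := by
    rcases lt_trichotomy ((e.sup : Fin n) : ℤ) ((e'.sup : Fin n) : ℤ) with hlt | heq | hlt
    · nlinarith
    · exact heq
    · nlinarith
  rw [key] at h
  refine Sym2.inf_eq_inf_and_sup_eq_sup.1 ⟨Fin.ext ?_, Fin.ext ?_⟩
  · omega
  · exact_mod_cast key

/-- The min ordering of `K_n`, induced by the labeling `minLabel`. -/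
def minOrdering (n : ℕ) : EdgeOrderedGraph (Fin n) :=
  complete n (LinearOrder.lift' (fun e => minLabel n e.1)
    ((minLabel_injective n).comp Subtype.val_injective))

/-- The max ordering of `K_n`, induced by the labeling `maxLabel`. -/
def maxOrdering (n : ℕ) : EdgeOrderedGraph (Fin n) :=
  complete n (LinearOrder.lift' (fun e => maxLabel n e.1)
    ((maxLabel_injective n).comp Subtype.val_injective))

/-- `x` is a minimal vertex of `F`: writing `f` for the number of vertices of `F`, the vertex `x`
plays the role of `v_1` in some embedding of `F` into the min ordering of `K_f`. -/
def IsMinimalVertex {V : Type u} [Fintype V] (F : EdgeOrderedGraph V) (x : V) : Prop :=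
  ∃ φ : Embedding F (minOrdering (Fintype.card V)), (φ.toCopy x).val = 0

/-- `x` is a maximal vertex of `F`: writing `f` for the number of vertices of `F`, the vertex `x`
plays the role of `v_f` in some embedding of `F` into the max ordering of `K_f`. -/
def IsMaximalVertex {V : Type u} [Fintype V] (F : EdgeOrderedGraph V) (x : V) : Prop :=
  ∃ φ : Embedding F (maxOrdering (Fintype.card V)), (φ.toCopy x).val + 1 = Fintype.card V

/-! ### Adding a smallest and a largest pendant edge

The new vertex set is `V ⊕ Bool`; the old vertices are `Sum.inl y` and the two new vertices are
`Sum.inr false` and `Sum.inr true`. -/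

/-- The new edge that joins the new vertex `Sum.inr false` to the old vertex `a`. -/
def lowEdge {V : Type u} (a : V) : Sym2 (V ⊕ Bool) := s(Sum.inr false, Sum.inl a)

/-- The new edge that joins the new vertex `Sum.inr true` to the old vertex `b`. -/
def highEdge {V : Type u} (b : V) : Sym2 (V ⊕ Bool) := s(Sum.inr true, Sum.inl b)

/-- The edge `e` of the old graph, as an edge of the new graph. -/
def oldEdge {V : Type u} (e : Sym2 V) : Sym2 (V ⊕ Bool) := e.map Sum.inl

/-- The graph obtained from `G` by adding two new vertices, one joined only to `a` and the other
joined only to `b`. -/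
def addPendantsGraph {V : Type u} (G : SimpleGraph V) (a b : V) : SimpleGraph (V ⊕ Bool) :=
  SimpleGraph.fromEdgeSet (oldEdge '' G.edgeSet ∪ {lowEdge a, highEdge b})

/-- The order of the edges of the new graph: `lowEdge a` is smaller than all other edges,
`highEdge b` is larger than all other edges, and the old edges are ordered as in `F`. -/
def addPendantsLT {V : Type u} (F : EdgeOrderedGraph V) (a b : V)
    (e e' : (addPendantsGraph F.graph a b).edgeSet) : Prop :=
  (e.1 = lowEdge a ∧ e'.1 ≠ lowEdge a) ∨
  (e.1 ≠ highEdge b ∧ e'.1 = highEdge b) ∨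
  ∃ d d' : F.graph.edgeSet, F.EdgeLT d d' ∧ e.1 = oldEdge d.1 ∧ e'.1 = oldEdge d'.1

theorem oldEdge_injective {V : Type u} : Function.Injective (oldEdge (V := V)) :=
  Sym2.map.injective Sum.inl_injective

theorem oldEdge_ne_lowEdge {V : Type u} (e : Sym2 V) (a : V) : oldEdge e ≠ lowEdge a := by
  induction e using Sym2.ind
  simp [oldEdge, lowEdge]

theorem oldEdge_ne_highEdge {V : Type u} (e : Sym2 V) (b : V) : oldEdge e ≠ highEdge b := by
  induction e using Sym2.ind
  simp [oldEdge, highEdge]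

theorem lowEdge_ne_highEdge {V : Type u} (a b : V) : lowEdge a ≠ highEdge b := by
  simp [lowEdge, highEdge]

theorem mem_edgeSet_addPendantsGraph {V : Type u} (G : SimpleGraph V) (a b : V)
    (e : Sym2 (V ⊕ Bool)) : e ∈ (addPendantsGraph G a b).edgeSet ↔
      (∃ d : G.edgeSet, e = oldEdge d.1) ∨ e = lowEdge a ∨ e = highEdge b := by
  have hdiag : ∀ e : Sym2 (V ⊕ Bool), ((∃ d : G.edgeSet, e = oldEdge d.1) ∨ e = lowEdge a ∨
      e = highEdge b) → ¬ e.IsDiag := by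
    rintro e (⟨⟨d, hd⟩, rfl⟩ | rfl | rfl)
    · have := G.not_isDiag_of_mem_edgeSet hd
      induction d using Sym2.ind
      simpa [oldEdge] using this
    · simp [lowEdge]
    · simp [highEdge]
  have hmem : e ∈ (addPendantsGraph G a b).edgeSet ↔
      ((∃ d : G.edgeSet, e = oldEdge d.1) ∨ e = lowEdge a ∨ e = highEdge b) ∧ ¬ e.IsDiag := by
    rw [addPendantsGraph, SimpleGraph.edgeSet_fromEdgeSet]
    refine and_congr ?_ (by simp)
    constructor
    · rintro (⟨d, hd, rfl⟩ | h)
      · exact Or.inl ⟨⟨d, hd⟩, rfl⟩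
      · exact Or.inr h
    · rintro (⟨d, rfl⟩ | h)
      · exact Or.inl ⟨d.1, d.2, rfl⟩
      · exact Or.inr h
  rw [hmem]
  exact ⟨fun h => h.1, fun h => ⟨h, hdiag e h⟩⟩

theorem isStrictTotalOrder_addPendantsLT {V : Type u} (F : EdgeOrderedGraph V) (a b : V) :
    IsStrictTotalOrder _ (addPendantsLT F a b) := by
  have hF1 : ∀ d : F.graph.edgeSet, ¬ F.EdgeLT d d :=
    @lt_irrefl _ F.edgeOrder.toPartialOrder.toPreorder
  have hF2 : ∀ d d' d'' : F.graph.edgeSet, F.EdgeLT d d' → F.EdgeLT d' d'' → F.EdgeLT d d'' :=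
    fun d d' d'' => @lt_trans _ F.edgeOrder.toPartialOrder.toPreorder d d' d''
  have hF3 : ∀ d d' : F.graph.edgeSet, ¬ F.EdgeLT d d' → ¬ F.EdgeLT d' d → d = d' :=
    fun d d' h h' => @le_antisymm _ F.edgeOrder.toPartialOrder d d'
      ((@not_lt _ F.edgeOrder d' d).1 h') ((@not_lt _ F.edgeOrder d d').1 h)
  have hlh := lowEdge_ne_highEdge a b
  have hold : ∀ d d' : F.graph.edgeSet, oldEdge d.1 = oldEdge d'.1 → d = d' :=
    fun d d' h => Subtype.ext (oldEdge_injective h)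
  have hirr : ∀ e, ¬ addPendantsLT F a b e e := by
    rintro e (⟨h, h'⟩ | ⟨h, h'⟩ | ⟨d, d', h, h1, h2⟩)
    · exact h' h
    · exact h h'
    · obtain rfl := hold _ _ (h1.symm.trans h2)
      exact hF1 _ h
  have htrans : ∀ e e' e'', addPendantsLT F a b e e' → addPendantsLT F a b e' e'' →
      addPendantsLT F a b e e'' := by
    rintro e e' e'' (⟨h, h'⟩ | ⟨h, h'⟩ | ⟨d, d', h, h1, h2⟩)
      (⟨k, k'⟩ | ⟨k, k'⟩ | ⟨c, c', k, k1, k2⟩)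
    · exact absurd k h'
    · exact Or.inl ⟨h, fun hh => hlh (hh.symm.trans k')⟩
    · exact Or.inl ⟨h, fun hh => oldEdge_ne_lowEdge _ _ (k2.symm.trans hh)⟩
    · exact absurd (k.symm.trans h') hlh
    · exact absurd h' k
    · exact absurd (k1.symm.trans h') (oldEdge_ne_highEdge _ _)
    · exact absurd (h2.symm.trans k) (oldEdge_ne_lowEdge _ _)
    · exact Or.inr (Or.inl ⟨fun hh => oldEdge_ne_highEdge _ _ (h1.symm.trans hh), k'⟩)
    · obtain rfl := hold _ _ (h2.symm.trans k1)
      exact Or.inr (Or.inr ⟨d, c', hF2 _ _ _ h k, h1, k2⟩)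
  have htri : ∀ e e', ¬ addPendantsLT F a b e e' → ¬ addPendantsLT F a b e' e → e = e' := by
    intro e e' h h'
    apply Subtype.ext
    by_contra hne
    rcases (mem_edgeSet_addPendantsGraph F.graph a b e.1).1 e.2 with ⟨d, hd⟩ | hl | hh
    · rcases (mem_edgeSet_addPendantsGraph F.graph a b e'.1).1 e'.2 with ⟨d', hd'⟩ | hl' | hh'
      · have hdd : d = d' := hF3 d d' (fun hlt => h (Or.inr (Or.inr ⟨d, d', hlt, hd, hd'⟩)))
          (fun hlt => h' (Or.inr (Or.inr ⟨d', d, hlt, hd', hd⟩)))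
        subst hdd
        exact hne (hd.trans hd'.symm)
      · exact h' (Or.inl ⟨hl', fun k => hne (k.trans hl'.symm)⟩)
      · exact h (Or.inr (Or.inl ⟨fun k => hne (k.trans hh'.symm), hh'⟩))
    · exact h (Or.inl ⟨hl, fun k => hne (hl.trans k.symm)⟩)
    · exact h' (Or.inr (Or.inl ⟨fun k => hne (hh.trans k.symm), hh⟩))
  exact { trichotomous := htri, irrefl := hirr, trans := htrans }

open scoped Classical in
/-- The edge-ordered graph obtained from `F` by adding two new vertices and two new edges: one that
joins a new vertex to `a` and is smaller than all other edges, and one that joins the other new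
vertex to `b` and is larger than all other edges. -/
noncomputable def addPendants {V : Type u} (F : EdgeOrderedGraph V) (a b : V) :
    EdgeOrderedGraph (V ⊕ Bool) where
  graph := addPendantsGraph F.graph a b
  edgeOrder :=
    haveI := isStrictTotalOrder_addPendantsLT F a b
    linearOrderOfSTO (addPendantsLT F a b)

end EdgeOrderedGraph

/-! The proof combines a covering statement with an absorption argument. Covering
(`IsSeed.exists_hasCover`): for some `N`, any vertex `x` and any `N` other vertices of an
edge-ordered complete graph contain a copy of `F'` through `x`, all of whose remaining vertices are
among those `N`.

Absorption (`exists_isTiled_univ`): put `k = |V(F')|`. Ramsey's theorem gives a large set `Q` whose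
`k`-subsets all span copies of `F'` or all fail to, and covering inside `Q` excludes the latter.
Vertices outside `Q` are covered greedily by copies avoiding `Q` until few are left; each of these
is covered with the help of `Q`, and what remains of `Q` is cut into arbitrary `k`-sets.

For covering, the canonical Ramsey theorem (`exists_isLex`) reduces to a sequence whose edges are
ordered by smaller endpoint, with rows (the edges from a term to later terms) all increasing or all
decreasing. The orders by larger endpoint arise by negating labels and exchanging `a` and `b`, which
is why `IsSeed` is symmetric. Minimality and maximality make the smallest edge of `F` meet `a` and
the largest meet `b`, so once `F` sits in such a sequence with gaps, a missing pendant edge is found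
by nudging the other endpoint of that extreme edge.

By Ramsey's theorem again, the edges at `x` compare uniformly with those of the sequence. If they
lie below everything, `x` is the low pendant vertex; if they lie above everything or just above the
rows, `x` is the high one. Otherwise the edge from `x` to a term lies just below the row of that
term. With increasing rows, minimality allows `a` to be the first vertex of the copy, and `x` is the
low pendant vertex. With decreasing rows, `x` behaves like a term after all others and replaces the
last vertex of a copy. -/

namespace EdgeOrderedGraph

/-! ### Ramsey's theorem for hypergraphs and for predicates on quadruples -/

/-- Ramsey's theorem for colourings of the `k`-subsets of a finite set. -/
theorem finset_ramsey {α κ : Type*} [DecidableEq α] [Finite κ] (k : ℕ) :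
    ∀ n : κ → ℕ, ∃ N : ℕ, ∀ S : Finset α, N ≤ S.card → ∀ χ : Finset α → κ,
      ∃ i, ∃ T ⊆ S, T.card = n i ∧ ∀ A ⊆ T, A.card = k → χ A = i := by
  classical
  have := Fintype.ofFinite κ
  induction k with
  | zero =>
    intro n
    refine ⟨Finset.univ.sup n, fun S hS χ => ?_⟩
    obtain ⟨T, hTS, hT⟩ := Finset.exists_subset_card_eq
      ((Finset.le_sup (f := n) (Finset.mem_univ (χ ∅))).trans hS)
    refine ⟨χ ∅, T, hTS, hT, fun A _ hA => ?_⟩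
    rw [Finset.card_eq_zero.1 hA]
  | succ k ih =>
    intro n
    induction hs : ∑ i, n i using Nat.strong_induction_on generalizing n with
    | _ s ihs =>
    by_cases h0 : ∃ i, n i = 0
    · obtain ⟨i, hi⟩ := h0
      refine ⟨0, fun S _ χ => ⟨i, ∅, Finset.empty_subset _, by simp [hi], fun A hA hc => ?_⟩⟩
      rw [Finset.subset_empty.1 hA] at hc
      simp at hc
    · push Not at h0
      have hstep : ∀ i, ∃ N : ℕ, ∀ S : Finset α, N ≤ S.card → ∀ χ : Finset α → κ,
          ∃ j, ∃ T ⊆ S, T.card = Function.update n i (n i - 1) j ∧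
            ∀ A ⊆ T, A.card = k + 1 → χ A = j := by
        intro i
        refine ihs _ ?_ _ rfl
        rw [← hs]
        refine Finset.sum_lt_sum (fun j _ => ?_) ⟨i, Finset.mem_univ _, ?_⟩
        · by_cases hj : j = i
          · subst hj; simp
          · simp [hj]
        · have := h0 i
          simp
          omega
      choose N hN using hstep
      obtain ⟨R, hR⟩ := ih (fun _ => Finset.univ.sup N)
      refine ⟨R + 1, fun S hS χ => ?_⟩
      obtain ⟨x, hx⟩ : S.Nonempty := Finset.card_pos.1 (by omega)
      -- On `T` the colour of `insert x A` is constantly `i`. Inside `T` only `n i - 1` vertices of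
      -- colour `i` are then needed, since `x` can be added to them.
      obtain ⟨i, T, hTS, hTc, hT⟩ := hR (S.erase x)
        (by rw [Finset.card_erase_of_mem hx]; omega) (fun A => χ (insert x A))
      have hxT : x ∉ T := fun h => Finset.notMem_erase x S (hTS h)
      have hTS' : T ⊆ S := hTS.trans (Finset.erase_subset _ _)
      obtain ⟨j, U, hUT, hUc, hU⟩ := hN i T
        (by rw [hTc]; exact Finset.le_sup (Finset.mem_univ i)) χ
      by_cases hj : j = i
      · subst hj
        refine ⟨j, insert x U, Finset.insert_subset hx (hUT.trans hTS'), ?_, fun A hA hc => ?_⟩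
        · rw [Finset.card_insert_of_notMem (fun h => hxT (hUT h)), hUc]
          have := h0 j
          simp
          omega
        · by_cases hxA : x ∈ A
          · have := hT (A.erase x) ((Finset.subset_insert_iff.1 hA).trans hUT)
                (by rw [Finset.card_erase_of_mem hxA, hc]; rfl)
            simpa [Finset.insert_erase hxA] using this
          · exact hU A ((Finset.subset_insert_iff_of_notMem hxA).1 hA) hc
      · exact ⟨j, U, hUT.trans hTS', by simpa [hj] using hUc, hU⟩

/-- Ramsey's theorem for finitely many predicates on increasing quadruples of natural numbers. -/
theorem exists_homogeneous_subseq (ι : Type*) [Finite ι] (n : ℕ) :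
    ∃ N : ℕ, ∀ P : ι → ℕ → ℕ → ℕ → ℕ → Prop, ∃ s : ℕ → ℕ, StrictMono s ∧ (∀ i < n, s i < N) ∧
      ∀ i, (∀ a b c d, a < b → b < c → c < d → d < n → P i (s a) (s b) (s c) (s d)) ∨
        (∀ a b c d, a < b → b < c → c < d → d < n → ¬ P i (s a) (s b) (s c) (s d)) := by
  classical
  obtain ⟨N, hN⟩ := finset_ramsey (α := ℕ) (κ := ι → Prop) 4 (fun _ => n)
  refine ⟨N, fun P => ?_⟩
  -- The colour of a 4-set is the vector of truth values of all predicates at its increasing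
  -- enumeration.
  obtain ⟨col, T, hTS, hTc, hT⟩ := hN (Finset.range N) (by simp) (fun A i =>
    ∃ a b c d, a < b ∧ b < c ∧ c < d ∧ A = {a, b, c, d} ∧ P i a b c d)
  -- The values `N + i` from index `n` on serve only to make `s` strictly increasing on all of `ℕ`.
  let s : ℕ → ℕ := fun i => if h : i < n then T.orderEmbOfFin hTc ⟨i, h⟩ else N + i
  have hs : ∀ i (h : i < n), s i = T.orderEmbOfFin hTc ⟨i, h⟩ := fun i h => by simp [s, h]
  have hsT : ∀ i < n, s i ∈ T := fun i h => by rw [hs i h]; exact T.orderEmbOfFin_mem hTc _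
  have hsN : ∀ i < n, s i < N := fun i h => Finset.mem_range.1 (hTS (hsT i h))
  have hmono : StrictMono s := by
    intro i j hij
    by_cases hj : j < n
    · rw [hs j hj, hs i (hij.trans hj)]
      exact (T.orderEmbOfFin hTc).strictMono hij
    · have h2 : s j = N + j := by simp [s, hj]
      by_cases hi : i < n
      · have := hsN i hi
        omega
      · have h1 : s i = N + i := by simp [s, hi]
        omega
  have huniq : ∀ a b c d a' b' c' d' : ℕ, a < b → b < c → c < d → a' < b' → b' < c' → c' < d' →
      ({a, b, c, d} : Finset ℕ) = {a', b', c', d'} → a = a' ∧ b = b' ∧ c = c' ∧ d = d' := by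
    intro a b c d a' b' c' d' h1 h2 h3 h4 h5 h6 h
    have e1 : a ∈ ({a', b', c', d'} : Finset ℕ) := by rw [← h]; simp
    have e2 : b ∈ ({a', b', c', d'} : Finset ℕ) := by rw [← h]; simp
    have e3 : c ∈ ({a', b', c', d'} : Finset ℕ) := by rw [← h]; simp
    have e4 : d ∈ ({a', b', c', d'} : Finset ℕ) := by rw [← h]; simp
    simp only [Finset.mem_insert, Finset.mem_singleton] at e1 e2 e3 e4
    omega
  refine ⟨s, hmono, hsN, fun i => ?_⟩
  have key : ∀ a b c d, a < b → b < c → c < d → d < n →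
      (P i (s a) (s b) (s c) (s d) ↔ col i) := by
    intro a b c d hab hbc hcd hd
    have h1 := hmono hab
    have h2 := hmono hbc
    have h3 := hmono hcd
    have := hT {s a, s b, s c, s d} (by
      intro y hy
      simp only [Finset.mem_insert, Finset.mem_singleton] at hy
      rcases hy with rfl | rfl | rfl | rfl <;> apply hsT <;> omega) (by
      rw [Finset.card_insert_of_notMem, Finset.card_insert_of_notMem,
        Finset.card_insert_of_notMem, Finset.card_singleton] <;> simp <;> omega)
    rw [← congrFun this i]
    constructor
    · exact fun h => ⟨_, _, _, _, h1, h2, h3, rfl, h⟩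
    · rintro ⟨a', b', c', d', h4, h5, h6, he, h⟩
      obtain ⟨rfl, rfl, rfl, rfl⟩ := huniq _ _ _ _ _ _ _ _ h1 h2 h3 h4 h5 h6 he
      exact h
  by_cases hc : col i
  · exact Or.inl fun a b c d h1 h2 h3 h4 => (key a b c d h1 h2 h3 h4).2 hc
  · exact Or.inr fun a b c d h1 h2 h3 h4 h => hc ((key a b c d h1 h2 h3 h4).1 h)

end EdgeOrderedGraph

namespace EdgeOrderedGraph

/-! ### Canonical edge-orderings of complete graphs -/

/-- A labelling of the edges of the complete graph on `W` with distinct labels. -/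
structure IsLabelling {W : Type*} (c : W → W → ℤ) : Prop where
  symm : ∀ a b, c a b = c b a
  inj : ∀ a b a' b', a ≠ b → a' ≠ b' → c a b = c a' b' → s(a, b) = s(a', b')

theorem IsLabelling.neg {W : Type*} {c : W → W → ℤ} (hc : IsLabelling c) :
    IsLabelling (fun a b => - c a b) where
  symm a b := by rw [hc.symm]
  inj a b a' b' h h' he := hc.inj a b a' b' h h' (neg_injective he)

theorem IsLabelling.lt_or_gt {W : Type*} {c : W → W → ℤ} (hc : IsLabelling c) {a b a' b' : W}
    (h : a ≠ b) (h' : a' ≠ b') (hne : s(a, b) ≠ s(a', b')) : c a b < c a' b' ∨ c a' b' < c a b :=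
  lt_or_gt_of_ne fun he => hne (hc.inj _ _ _ _ h h' he)

/-- Along the first `n` terms of `q`, the edges are ordered lexicographically: first by their
smaller endpoint, increasingly, and then by their larger endpoint, increasingly or decreasingly. -/
structure IsLex {W : Type*} (c : W → W → ℤ) (q : ℕ → W) (n : ℕ) : Prop where
  block : ∀ i j k l, i < j → k < l → j < n → l < n → i < k → c (q i) (q j) < c (q k) (q l)
  row : (∀ i j k, i < j → j < k → k < n → c (q i) (q j) < c (q i) (q k)) ∨
    (∀ i j k, i < j → j < k → k < n → c (q i) (q k) < c (q i) (q j))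

/-- The nested pairs in `h3` decide the type: if the outer edge is smaller, the smaller endpoint
governs the order, otherwise the larger one does. The remaining alternatives needed are then forced,
because the wrong choice closes a cycle with the increasing chain of consecutive edges from `h2`;
six indices suffice for these cycles. -/
theorem lex_of_homogeneous {n : ℕ} (hn : 8 ≤ n) (e : ℕ → ℕ → ℤ)
    (h1 : (∀ a b c, a < b → b < c → c < n → e a c < e b c) ∨
      (∀ a b c, a < b → b < c → c < n → e b c < e a c))
    (h2 : ∀ a b c, a < b → b < c → c < n → e a b < e b c)
    (h3 : (∀ a b c d, a < b → b < c → c < d → d < n → e a d < e b c) ∨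
      (∀ a b c d, a < b → b < c → c < d → d < n → e b c < e a d))
    (h4 : (∀ a b c d, a < b → b < c → c < d → d < n → e a c < e b d) ∨
      (∀ a b c d, a < b → b < c → c < d → d < n → e b d < e a c))
    (h0 : (∀ a b c, a < b → b < c → c < n → e a b < e a c) ∨
      (∀ a b c, a < b → b < c → c < n → e a c < e a b)) :
    (∀ i j k l, i < j → k < l → j < n → l < n → i < k → e i j < e k l) ∨
    (∀ i j k l, i < j → k < l → j < n → l < n → j < l → e i j < e k l) := by
  have q1 := h2 0 1 2 (by omega) (by omega) (by omega)
  have q2 := h2 1 2 3 (by omega) (by omega) (by omega)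
  have q3 := h2 2 3 4 (by omega) (by omega) (by omega)
  have q4 := h2 3 4 5 (by omega) (by omega) (by omega)
  have q5 := h2 2 3 5 (by omega) (by omega) (by omega)
  have q6 := h2 0 2 3 (by omega) (by omega) (by omega)
  rcases h3 with h3 | h3
  · left
    have h1' : ∀ a b c, a < b → b < c → c < n → e a c < e b c := by
      refine h1.resolve_right fun h => ?_
      have r1 := h 0 4 5 (by omega) (by omega) (by omega)
      have r2 := h3 0 1 2 5 (by omega) (by omega) (by omega) (by omega)
      omega
    have h4' : ∀ a b c d, a < b → b < c → c < d → d < n → e a c < e b d := by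
      refine h4.resolve_right fun h => ?_
      have r1 := h 0 3 4 5 (by omega) (by omega) (by omega) (by omega)
      have r2 := h3 0 1 2 4 (by omega) (by omega) (by omega) (by omega)
      omega
    intro i j k l hij hkl hj hl hik
    rcases lt_trichotomy j k with h | h | h
    · exact (h2 i j k hij h (by omega)).trans (h2 j k l h hkl hl)
    · subst h; exact h2 i j l hij hkl hl
    · rcases lt_trichotomy l j with h' | h' | h'
      · exact h3 i k l j hik hkl h' hj
      · subst h'; exact h1' i k l hik hkl hl
      · exact h4' i k j l hik h h' hl
  · right
    have h0' : ∀ a b c, a < b → b < c → c < n → e a b < e a c := by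
      refine h0.resolve_right fun h => ?_
      have r1 := h 0 1 4 (by omega) (by omega) (by omega)
      have r2 := h3 0 2 3 4 (by omega) (by omega) (by omega) (by omega)
      omega
    have h4' : ∀ a b c d, a < b → b < c → c < d → d < n → e a c < e b d := by
      refine h4.resolve_right fun h => ?_
      have r1 := h 0 1 2 5 (by omega) (by omega) (by omega) (by omega)
      have r2 := h3 1 3 4 5 (by omega) (by omega) (by omega) (by omega)
      omega
    intro i j k l hij hkl hj hl hjl
    rcases lt_trichotomy j k with h | h | h
    · exact (h2 i j k hij h (by omega)).trans (h2 j k l h hkl hl)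
    · subst h; exact h2 i j l hij hkl hl
    · rcases lt_trichotomy i k with h' | h' | h'
      · exact h4' i k j l h' h hjl hl
      · subst h'; exact h0' i j l hij hjl hl
      · exact h3 k i j l h' hij hjl hl

/-- Reversing the sequence and negating the labels turns an order governed by larger endpoints into
one governed by smaller endpoints, so `IsLex` covers both outcomes. -/
theorem isLex_of_homogeneous {W : Type*} {n : ℕ} (hn : 8 ≤ n) (c : W → W → ℤ)
    (hc : ∀ a b, c a b = c b a) (q : ℕ → W)
    (h0 : (∀ i j k, i < j → j < k → k < n → c (q i) (q j) < c (q i) (q k)) ∨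
      (∀ i j k, i < j → j < k → k < n → c (q i) (q k) < c (q i) (q j)))
    (h1 : (∀ i j k, i < j → j < k → k < n → c (q i) (q k) < c (q j) (q k)) ∨
      (∀ i j k, i < j → j < k → k < n → c (q j) (q k) < c (q i) (q k)))
    (h2 : ∀ i j k, i < j → j < k → k < n → c (q i) (q j) < c (q j) (q k))
    (h3 : (∀ i j k l, i < j → j < k → k < l → l < n → c (q i) (q l) < c (q j) (q k)) ∨
      (∀ i j k l, i < j → j < k → k < l → l < n → c (q j) (q k) < c (q i) (q l)))
    (h4 : (∀ i j k l, i < j → j < k → k < l → l < n → c (q i) (q k) < c (q j) (q l)) ∨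
      (∀ i j k l, i < j → j < k → k < l → l < n → c (q j) (q l) < c (q i) (q k))) :
    IsLex c q n ∨ IsLex (fun a b => - c a b) (fun i => q (n - 1 - i)) n := by
  rcases lex_of_homogeneous hn (fun i j => c (q i) (q j)) h1 h2 h3 h4 h0 with h | h
  · exact Or.inl ⟨h, h0⟩
  · refine Or.inr ⟨fun i j k l hij hkl hj hl hik => ?_, ?_⟩
    · have := h (n - 1 - l) (n - 1 - k) (n - 1 - j) (n - 1 - i) (by omega) (by omega) (by omega)
        (by omega) (by omega)
      rw [hc (q (n - 1 - i)), hc (q (n - 1 - k))]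
      omega
    · refine h1.imp (fun h1 i j k hij hjk hk => ?_) (fun h1 i j k hij hjk hk => ?_)
      · have := h1 (n - 1 - k) (n - 1 - j) (n - 1 - i) (by omega) (by omega) (by omega)
        rw [hc (q (n - 1 - i)), hc (q (n - 1 - i))]
        omega
      · have := h1 (n - 1 - k) (n - 1 - j) (n - 1 - i) (by omega) (by omega) (by omega)
        rw [hc (q (n - 1 - i)), hc (q (n - 1 - i))]
        omega

theorem IsLex.mono {W : Type*} {c : W → W → ℤ} {q : ℕ → W} {n m : ℕ} (h : IsLex c q n)
    (s : ℕ → ℕ) (hs : StrictMono s) (hsn : ∀ i < m, s i < n) : IsLex c (fun i => q (s i)) m where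
  block _ _ _ _ hij hkl hj hl hik :=
    h.block _ _ _ _ (hs hij) (hs hkl) (hsn _ hj) (hsn _ hl) (hs hik)
  row := h.row.imp (fun h _ _ _ hij hjk hk => h _ _ _ (hs hij) (hs hjk) (hsn _ hk))
    (fun h _ _ _ hij hjk hk => h _ _ _ (hs hij) (hs hjk) (hsn _ hk))

theorem IsLex.of_le {W : Type*} {c : W → W → ℤ} {q : ℕ → W} {n m : ℕ} (h : IsLex c q n)
    (hmn : m ≤ n) : IsLex c q m :=
  h.mono id strictMono_id fun _ hi => lt_of_lt_of_le hi hmn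

/-- The canonical Ramsey theorem for edge-orderings of complete graphs: a long sequence has a
long (possibly reversed) subsequence which is lexicographic for the labelling or its negative. -/
theorem exists_isLex (n : ℕ) : ∃ N : ℕ, ∀ {W : Type} (c : W → W → ℤ), IsLabelling c →
    ∀ q : ℕ → W, (∀ i j, i < N → j < N → q i = q j → i = j) →
    ∃ r : ℕ → ℕ, (∀ i < n, r i < N) ∧ (∀ i j, i < n → j < n → r i = r j → i = j) ∧
      (IsLex c (fun i => q (r i)) n ∨ IsLex (fun a b => - c a b) (fun i => q (r i)) n) := by
  -- Three of the predicates ignore their last index; the extra term `n + 8` fills that place for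
  -- all triples below `n + 8`. Keeping `n + 8` terms meets the length requirement of
  -- `isLex_of_homogeneous`.
  obtain ⟨N, hN⟩ := exists_homogeneous_subseq (Fin 5) (n + 9)
  refine ⟨N, fun {W} c hc q hq => ?_⟩
  obtain ⟨s, hs, hsN, hP⟩ := hN ![fun i j k _ => c (q i) (q j) < c (q i) (q k),
    fun i j k _ => c (q i) (q k) < c (q j) (q k),
    fun i j k _ => c (q i) (q j) < c (q j) (q k),
    fun i j k l => c (q i) (q l) < c (q j) (q k),
    fun i j k l => c (q i) (q k) < c (q j) (q l)]
  set p : ℕ → W := fun i => q (s i) with hp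
  have hpi : ∀ i j, i < n + 8 → j < n + 8 → p i = p j → i = j := fun i j hi hj h =>
    hs.injective (hq _ _ (hsN i (by omega)) (hsN j (by omega)) h)
  have hlt : ∀ i j k l, i < j → k < l → j < n + 8 → l < n + 8 → (i ≠ k ∨ j ≠ l) →
      ¬ c (p i) (p j) < c (p k) (p l) → c (p k) (p l) < c (p i) (p j) := by
    intro i j k l hij hkl hj hl hne h
    refine (hc.lt_or_gt ?_ ?_ ?_).resolve_left h
    · exact fun h => absurd (hpi i j (by omega) hj h) (by omega)
    · exact fun h => absurd (hpi k l (by omega) hl h) (by omega)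
    · intro h
      rcases Sym2.eq_iff.1 h with ⟨h1, h2⟩ | ⟨h1, h2⟩
      · have := hpi _ _ (by omega) (by omega) h1
        have := hpi _ _ (by omega) (by omega) h2
        omega
      · have := hpi _ _ (by omega) (by omega) h1
        have := hpi _ _ (by omega) (by omega) h2
        omega
  have a0 : (∀ i j k, i < j → j < k → k < n + 8 → c (p i) (p j) < c (p i) (p k)) ∨
      (∀ i j k, i < j → j < k → k < n + 8 → c (p i) (p k) < c (p i) (p j)) :=
    (hP 0).imp (fun h i j k hij hjk hk => h i j k (n + 8) hij hjk hk (by omega))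
      (fun h i j k hij hjk hk => hlt _ _ _ _ (by omega) (by omega) (by omega) (by omega) (by omega)
        (h i j k (n + 8) hij hjk hk (by omega)))
  have a1 : (∀ i j k, i < j → j < k → k < n + 8 → c (p i) (p k) < c (p j) (p k)) ∨
      (∀ i j k, i < j → j < k → k < n + 8 → c (p j) (p k) < c (p i) (p k)) :=
    (hP 1).imp (fun h i j k hij hjk hk => h i j k (n + 8) hij hjk hk (by omega))
      (fun h i j k hij hjk hk => hlt _ _ _ _ (by omega) (by omega) (by omega) (by omega) (by omega)
        (h i j k (n + 8) hij hjk hk (by omega)))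
  have a2 : (∀ i j k, i < j → j < k → k < n + 8 → c (p i) (p j) < c (p j) (p k)) ∨
      (∀ i j k, i < j → j < k → k < n + 8 → c (p j) (p k) < c (p i) (p j)) :=
    (hP 2).imp (fun h i j k hij hjk hk => h i j k (n + 8) hij hjk hk (by omega))
      (fun h i j k hij hjk hk => hlt _ _ _ _ (by omega) (by omega) (by omega) (by omega) (by omega)
        (h i j k (n + 8) hij hjk hk (by omega)))
  have a3 : (∀ i j k l, i < j → j < k → k < l → l < n + 8 → c (p i) (p l) < c (p j) (p k)) ∨
      (∀ i j k l, i < j → j < k → k < l → l < n + 8 → c (p j) (p k) < c (p i) (p l)) :=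
    (hP 3).imp (fun h i j k l hij hjk hkl hl => h i j k l hij hjk hkl (by omega))
      (fun h i j k l hij hjk hkl hl => hlt _ _ _ _ (by omega) (by omega) (by omega) (by omega)
        (by omega) (h i j k l hij hjk hkl (by omega)))
  have a4 : (∀ i j k l, i < j → j < k → k < l → l < n + 8 → c (p i) (p k) < c (p j) (p l)) ∨
      (∀ i j k l, i < j → j < k → k < l → l < n + 8 → c (p j) (p l) < c (p i) (p k)) :=
    (hP 4).imp (fun h i j k l hij hjk hkl hl => h i j k l hij hjk hkl (by omega))
      (fun h i j k l hij hjk hkl hl => hlt _ _ _ _ (by omega) (by omega) (by omega) (by omega)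
        (by omega) (h i j k l hij hjk hkl (by omega)))
  have main : IsLex c p (n + 8) ∨
        IsLex (fun a b => - c a b) (fun i => p (n + 8 - 1 - i)) (n + 8) ∨
      IsLex (fun a b => - c a b) p (n + 8) ∨ IsLex c (fun i => p (n + 8 - 1 - i)) (n + 8) := by
    -- If consecutive edges decrease, negating the labels makes them increase.
    rcases a2 with a2 | a2
    · rcases isLex_of_homogeneous (by omega) c hc.symm p a0 a1 a2 a3 a4 with h | h
      · exact Or.inl h
      · exact Or.inr (Or.inl h)
    · have := isLex_of_homogeneous (n := n + 8) (by omega) (fun a b => - c a b) hc.neg.symm p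
        (by simpa only [neg_lt_neg_iff] using a0.symm) (by simpa only [neg_lt_neg_iff] using a1.symm)
        (by simpa only [neg_lt_neg_iff] using a2) (by simpa only [neg_lt_neg_iff] using a3.symm)
        (by simpa only [neg_lt_neg_iff] using a4.symm)
      simp only [neg_neg] at this
      exact Or.inr (Or.inr this)
  have fwd : ∀ c' : W → W → ℤ, IsLex c' p (n + 8) → IsLex c' (fun i => q (s i)) n :=
    fun c' h => h.of_le (by omega)
  have bwd : ∀ c' : W → W → ℤ, IsLex c' (fun i => p (n + 8 - 1 - i)) (n + 8) →
      IsLex c' (fun i => q (s (n + 8 - 1 - i))) n :=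
    fun c' h => h.of_le (by omega)
  have hfwd : (∀ i < n, s i < N) ∧ (∀ i j, i < n → j < n → s i = s j → i = j) :=
    ⟨fun i hi => hsN i (by omega), fun i j _ _ h => hs.injective h⟩
  have hbwd : (∀ i < n, s (n + 8 - 1 - i) < N) ∧
      (∀ i j, i < n → j < n → s (n + 8 - 1 - i) = s (n + 8 - 1 - j) → i = j) :=
    ⟨fun i hi => hsN _ (by omega), fun i j _ _ h => by have := hs.injective h; omega⟩
  rcases main with h | h | h | h
  · exact ⟨s, hfwd.1, hfwd.2, Or.inl (fwd _ h)⟩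
  · exact ⟨_, hbwd.1, hbwd.2, Or.inr (bwd _ h)⟩
  · exact ⟨s, hfwd.1, hfwd.2, Or.inr (fwd _ h)⟩
  · exact ⟨_, hbwd.1, hbwd.2, Or.inl (bwd _ h)⟩

end EdgeOrderedGraph

namespace EdgeOrderedGraph

/-! ### Pendant copies in lexicographic sequences -/

section Labelled
variable {V : Type*} {W : Type}

/-- `φ` maps the edges of `G`, ordered by the labels `l`, increasingly to edges labelled by `c`. -/
def IsMonotoneMap (G : SimpleGraph V) (l : V → V → ℤ) (c : W → W → ℤ) (φ : V → W) : Prop :=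
  ∀ x y z w, G.Adj x y → G.Adj z w → l x y < l z w → c (φ x) (φ y) < c (φ z) (φ w)

/-- The map `φ` and the vertices `p`, `r` form a copy of the graph `G` with edges labelled by `l`,
together with a smallest pendant edge at `a` and a largest pendant edge at `b`. -/
structure IsPendantCopy (G : SimpleGraph V) (l : V → V → ℤ) (a b : V) (c : W → W → ℤ)
    (φ : V → W) (p r : W) : Prop where
  inj : Function.Injective φ
  low_notMem : ∀ x, φ x ≠ p
  high_notMem : ∀ x, φ x ≠ r
  ne : p ≠ r
  mono : IsMonotoneMap G l c φ
  low : ∀ x y, G.Adj x y → c p (φ a) < c (φ x) (φ y)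
  high : ∀ x y, G.Adj x y → c (φ x) (φ y) < c r (φ b)

/-- The vertices of a pendant copy. -/
def pendantSupport (φ : V → W) (p r : W) : Set W := insert p (insert r (Set.range φ))

/-- There is an injection of the vertices into `{0, …, t - 1}` which maps `a` to `0` and under which
the labels `l` increase in the lexicographic order of the edges. -/
def HasLexMap (G : SimpleGraph V) (l : V → V → ℤ) (a : V) (t : ℕ) : Prop :=
  ∃ φ : V → ℕ, Function.Injective φ ∧ (∀ x, φ x < t) ∧ φ a = 0 ∧
    ∀ x y z w, G.Adj x y → G.Adj z w → l x y < l z w →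
      min (φ x) (φ y) < min (φ z) (φ w) ∨
        (min (φ x) (φ y) = min (φ z) (φ w) ∧ max (φ x) (φ y) < max (φ z) (φ w))

/-- The hypotheses on a graph with labelled edges and two vertices `a`, `b` under which pendant
copies are found. They are invariant under negating the labels and exchanging `a` and `b`. -/
structure IsSeed (G : SimpleGraph V) (l : V → V → ℤ) (a b : V) (t : ℕ) : Prop where
  inj : ∀ x y z w, G.Adj x y → G.Adj z w → l x y = l z w → s(x, y) = s(z, w)
  low : ∃ w, G.Adj a w ∧ ∀ x y, G.Adj x y → l a w ≤ l x y
  high : ∃ w, G.Adj b w ∧ ∀ x y, G.Adj x y → l x y ≤ l b w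
  first : HasLexMap G l a t
  last : HasLexMap G (fun x y => - l x y) b t
  turan : ∀ (W : Type) (c : W → W → ℤ), IsLabelling c → ∀ q : ℕ → W,
    (∀ i j, i < t → j < t → q i = q j → i = j) →
    ∃ φ : V → ℕ, Function.Injective φ ∧ (∀ x, φ x < t) ∧ IsMonotoneMap G l c (fun x => q (φ x))

variable {G : SimpleGraph V} {l : V → V → ℤ} {a b : V} {t : ℕ} {c : W → W → ℤ}

theorem IsMonotoneMap.neg_iff {φ : V → W} :
    IsMonotoneMap G (fun x y => - l x y) (fun x y => - c x y) φ ↔ IsMonotoneMap G l c φ := by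
  constructor <;> intro h x y z w hxy hzw hlt
  · simpa using h z w x y hzw hxy (by simpa using hlt)
  · simpa using h z w x y hzw hxy (by simpa using hlt)

theorem IsSeed.neg (h : IsSeed G l a b t) : IsSeed G (fun x y => - l x y) b a t where
  inj x y z w hxy hzw he := h.inj x y z w hxy hzw (neg_injective he)
  low := by
    obtain ⟨w, hw, h'⟩ := h.high
    exact ⟨w, hw, fun x y hxy => neg_le_neg (h' x y hxy)⟩
  high := by
    obtain ⟨w, hw, h'⟩ := h.low
    exact ⟨w, hw, fun x y hxy => neg_le_neg (h' x y hxy)⟩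
  first := h.last
  last := by simpa only [neg_neg] using h.first
  turan W c hc q hq := by
    obtain ⟨φ, h1, h2, h3⟩ := h.turan W _ hc.neg q hq
    refine ⟨φ, h1, h2, IsMonotoneMap.neg_iff.1 ?_⟩
    simpa only [neg_neg] using h3

theorem IsPendantCopy.of_neg {φ : V → W} {p r : W}
    (h : IsPendantCopy G (fun x y => - l x y) b a (fun x y => - c x y) φ r p) :
    IsPendantCopy G l a b c φ p r where
  inj := h.inj
  low_notMem := h.high_notMem
  high_notMem := h.low_notMem
  ne := h.ne.symm
  mono := IsMonotoneMap.neg_iff.1 h.mono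
  low x y hxy := neg_lt_neg_iff.1 (h.high x y hxy)
  high x y hxy := neg_lt_neg_iff.1 (h.low x y hxy)

theorem IsMonotoneMap.le_of_le (hl : IsSeed G l a b t) (hc : IsLabelling c) {φ : V → W}
    (h : IsMonotoneMap G l c φ) {x y z w : V} (hxy : G.Adj x y) (hzw : G.Adj z w)
    (hle : l x y ≤ l z w) : c (φ x) (φ y) ≤ c (φ z) (φ w) := by
  rcases hle.lt_or_eq with hlt | heq
  · exact (h x y z w hxy hzw hlt).le
  · rcases Sym2.eq_iff.1 (hl.inj _ _ _ _ hxy hzw heq) with ⟨rfl, rfl⟩ | ⟨rfl, rfl⟩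
    · exact le_rfl
    · rw [hc.symm]

/-- The endpoint `w` is moved by `d` to one side or the other. If `w` is the smaller endpoint,
`block` tells which side lowers the label; if it is the larger, the direction of the rows does. A
gap of more than `d` prevents the move from passing `v`. -/
theorem IsLex.exists_near {q : ℕ → W} {n : ℕ} (hc : IsLabelling c) (h : IsLex c q n) {w v d : ℕ}
    (hd : 0 < d) (hdw : d ≤ w) (hwn : w + d < n) (hv : v < n) (hwv : w + d < v ∨ v + d < w) :
    (∃ p, (p + d = w ∨ p = w + d) ∧ c (q p) (q v) < c (q w) (q v)) ∧
    (∃ p, (p + d = w ∨ p = w + d) ∧ c (q w) (q v) < c (q p) (q v)) := by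
  rcases hwv with hwv | hwv
  · exact ⟨⟨w - d, by omega, h.block _ _ _ _ (by omega) (by omega) hv hv (by omega)⟩,
      ⟨w + d, by omega, h.block _ _ _ _ (by omega) (by omega) hv hv (by omega)⟩⟩
  · simp only [hc.symm _ (q v)]
    rcases h.row with hr | hr
    · exact ⟨⟨w - d, by omega, hr _ _ _ (by omega) (by omega) (by omega)⟩,
        ⟨w + d, by omega, hr _ _ _ (by omega) (by omega) (by omega)⟩⟩
    · exact ⟨⟨w + d, by omega, hr _ _ _ (by omega) (by omega) (by omega)⟩,
        ⟨w - d, by omega, hr _ _ _ (by omega) (by omega) (by omega)⟩⟩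

/-- The smallest edge of `G` is some `aw`; moving the image of `w` by one position gives a still
smaller edge at `a`. The copy occupies residue 2 modulo 5, so the new vertex has residue 1 or 3. In
`exists_high` the move is by two positions, giving residue 0 or 4, so the two pendant vertices never
collide with each other or with the copy. -/
theorem IsSeed.exists_low (hl : IsSeed G l a b t) (hc : IsLabelling c) {q : ℕ → W} {n : ℕ}
    (h : IsLex c q n) {φ : V → ℕ} (hφ : Function.Injective φ) (hφ5 : ∀ x, φ x % 5 = 2)
    (hφn : ∀ x, φ x + 2 < n) (hm : IsMonotoneMap G l c (fun x => q (φ x))) :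
    ∃ p, p < n ∧ (p % 5 = 1 ∨ p % 5 = 3) ∧
      ∀ x y, G.Adj x y → c (q p) (q (φ a)) < c (q (φ x)) (q (φ y)) := by
  obtain ⟨w, haw, hw⟩ := hl.low
  have h1 := hφ5 w
  have h2 := hφ5 a
  have h3 := hφn w
  have h4 := hφn a
  have h5 : φ a ≠ φ w := fun h => haw.ne (hφ h)
  obtain ⟨p, hp, hlt⟩ := (h.exists_near hc (w := φ w) (v := φ a) (d := 1) (by omega) (by omega)
    (by omega) (by omega) (by omega)).1
  refine ⟨p, by omega, by omega, fun x y hxy => hlt.trans_le ?_⟩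
  rw [hc.symm]
  exact hm.le_of_le hl hc haw hxy (hw x y hxy)

theorem IsSeed.exists_high (hl : IsSeed G l a b t) (hc : IsLabelling c) {q : ℕ → W} {n : ℕ}
    (h : IsLex c q n) {φ : V → ℕ} (hφ : Function.Injective φ) (hφ5 : ∀ x, φ x % 5 = 2)
    (hφn : ∀ x, φ x + 2 < n) (hm : IsMonotoneMap G l c (fun x => q (φ x))) :
    ∃ r, r < n ∧ (r % 5 = 0 ∨ r % 5 = 4) ∧
      ∀ x y, G.Adj x y → c (q (φ x)) (q (φ y)) < c (q r) (q (φ b)) := by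
  obtain ⟨w, hbw, hw⟩ := hl.high
  have h1 := hφ5 w
  have h2 := hφ5 b
  have h3 := hφn w
  have h4 := hφn b
  have h5 : φ b ≠ φ w := fun h => hbw.ne (hφ h)
  obtain ⟨p, hp, hlt⟩ := (h.exists_near hc (w := φ w) (v := φ b) (d := 2) (by omega) (by omega)
    (by omega) (by omega) (by omega)).2
  refine ⟨p, by omega, by omega, fun x y hxy => lt_of_le_of_lt ?_ hlt⟩
  rw [hc.symm (q (φ w))]
  exact hm.le_of_le hl hc hxy hbw (hw x y hxy)

/-- Turánability is applied to every fifth term, which leaves room for pendant vertices around each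
vertex of the copy. The offset `o` keeps an initial segment free. -/
theorem IsSeed.exists_spread (hl : IsSeed G l a b t) (hc : IsLabelling c) {q : ℕ → W} {n o : ℕ}
    (hq : ∀ i j, i < n → j < n → q i = q j → i = j) (hn : 5 * (t + o) ≤ n) :
    ∃ φ : V → ℕ, Function.Injective φ ∧ (∀ x, φ x % 5 = 2) ∧ (∀ x, φ x + 2 < 5 * (t + o)) ∧
      (∀ x, 5 * o + 2 ≤ φ x) ∧ IsMonotoneMap G l c (fun x => q (φ x)) := by
  obtain ⟨φ, h1, h2, h3⟩ := hl.turan W c hc (fun i => q (5 * (i + o) + 2)) (fun i j hi hj h => by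
    have := hq _ _ (by omega) (by omega) h
    omega)
  refine ⟨fun x => 5 * (φ x + o) + 2, fun x y h => h1 ?_, fun x => ?_, fun x => ?_, fun x => ?_, h3⟩
  · simp only at h; omega
  · simp only; omega
  · have := h2 x
    simp only; omega
  · simp only; omega

theorem IsSeed.exists_copy_of_isLex (hl : IsSeed G l a b t) (hc : IsLabelling c) {q : ℕ → W}
    {n : ℕ} (hq : ∀ i j, i < n → j < n → q i = q j → i = j) (h : IsLex c q n) (hn : 5 * t ≤ n) :
    ∃ (φ : V → ℕ) (p r : ℕ), (∀ x, φ x < n) ∧ p < n ∧ r < n ∧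
      IsPendantCopy G l a b c (fun x => q (φ x)) (q p) (q r) := by
  obtain ⟨φ, h1, h2, h3, -, h4⟩ := hl.exists_spread (o := 0) hc hq (by omega)
  have h3' : ∀ x, φ x + 2 < n := fun x => (h3 x).trans_le (by omega)
  obtain ⟨p, hp, hp5, hpl⟩ := hl.exists_low hc h h1 h2 h3' h4
  obtain ⟨r, hr, hr5, hrh⟩ := hl.exists_high hc h h1 h2 h3' h4
  refine ⟨φ, p, r, fun x => by have := h3' x; omega, hp, hr, fun x y hxy => ?_, fun x hx => ?_,
    fun x hx => ?_, fun hx => ?_, h4, hpl, hrh⟩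
  · exact h1 (hq _ _ (by have := h3' x; omega) (by have := h3' y; omega) hxy)
  · have := h3' x
    have := h2 x
    have := hq _ _ (by omega) hp hx
    omega
  · have := h3' x
    have := h2 x
    have := hq _ _ (by omega) hr hx
    omega
  · have := hq _ _ hp hr hx
    omega

theorem IsLex.lt_of_inc {q : ℕ → W} {n : ℕ} (hc : IsLabelling c) (h : IsLex c q n)
    (hr : ∀ i j k, i < j → j < k → k < n → c (q i) (q j) < c (q i) (q k)) {i j k m : ℕ}
    (hij : i ≠ j) (hkm : k ≠ m) (hi : i < n) (hj : j < n) (hk : k < n) (hm : m < n)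
    (hlt : min i j < min k m ∨ (min i j = min k m ∧ max i j < max k m)) :
    c (q i) (q j) < c (q k) (q m) := by
  wlog hij' : i < j generalizing i j
  · rw [hc.symm]
    exact this hij.symm hj hi (by rwa [min_comm j, max_comm j]) (by omega)
  wlog hkm' : k < m generalizing k m
  · rw [hc.symm (q k)]
    exact this hkm.symm hm hk (by rwa [min_comm m, max_comm m]) (by omega)
  rcases hlt with hlt | ⟨he, hlt⟩
  · exact h.block _ _ _ _ hij' hkm' hj hm (by omega)
  · obtain rfl : i = k := by omega
    exact hr _ _ _ hij' (by omega) hm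

/-- The order of the edges is determined by the indices alone, so any two such sequences are
order-isomorphic. This is what permits exchanging one term for `x` in
`IsSeed.hasCover_of_lt_row_dec`. -/
theorem IsLex.lt_iff_of_dec {q : ℕ → W} {n : ℕ} (hc : IsLabelling c) (h : IsLex c q n)
    (hr : ∀ i j k, i < j → j < k → k < n → c (q i) (q k) < c (q i) (q j)) {i j k m : ℕ}
    (hij : i ≠ j) (hkm : k ≠ m) (hi : i < n) (hj : j < n) (hk : k < n) (hm : m < n) :
    c (q i) (q j) < c (q k) (q m) ↔
      min i j < min k m ∨ (min i j = min k m ∧ max k m < max i j) := by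
  wlog hij' : i < j generalizing i j
  · rw [hc.symm, min_comm i, max_comm i]
    exact this hij.symm hj hi (by omega)
  wlog hkm' : k < m generalizing k m
  · rw [hc.symm (q k), min_comm k, max_comm k]
    exact this hkm.symm hm hk (by omega)
  rw [min_eq_left hij'.le, min_eq_left hkm'.le, max_eq_right hij'.le, max_eq_right hkm'.le]
  rcases lt_trichotomy i k with hik | rfl | hik
  · simp [hik, h.block _ _ _ _ hij' hkm' hj hm hik]
  · rcases lt_trichotomy j m with hjm | rfl | hjm
    · have := hr _ _ _ hij' hjm hm
      constructor <;> intro <;> omega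
    · simp
    · have := hr _ _ _ hkm' hjm hj
      constructor <;> intro <;> omega
  · have := h.block _ _ _ _ hkm' hij' hm hj hik
    constructor <;> intro <;> omega

/-- A pendant copy stays one when its vertices are replaced in an order-preserving way. -/
theorem IsPendantCopy.transfer {q q' : ℕ → W} {n : ℕ} {φ : V → ℕ} {p r : ℕ}
    (h : IsPendantCopy G l a b c (fun x => q (φ x)) (q p) (q r))
    (hφ : ∀ x, φ x < n) (hp : p < n) (hr : r < n)
    (hq' : ∀ i j, i < n → j < n → q' i = q' j → i = j)
    (hlt : ∀ i j k m, i ≠ j → k ≠ m → i < n → j < n → k < n → m < n →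
      c (q i) (q j) < c (q k) (q m) → c (q' i) (q' j) < c (q' k) (q' m)) :
    IsPendantCopy G l a b c (fun x => q' (φ x)) (q' p) (q' r) := by
  have hinj : Function.Injective φ := fun x y hxy => h.inj (congrArg q hxy)
  have hadj : ∀ x y, G.Adj x y → φ x ≠ φ y := fun x y hxy he => hxy.ne (hinj he)
  have hpa : ∀ x, φ x ≠ p := fun x he => h.low_notMem x (congrArg q he)
  have hra : ∀ x, φ x ≠ r := fun x he => h.high_notMem x (congrArg q he)
  exact {
    inj := fun x y hxy => hinj (hq' _ _ (hφ x) (hφ y) hxy)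
    low_notMem := fun x hx => hpa x (hq' _ _ (hφ x) hp hx)
    high_notMem := fun x hx => hra x (hq' _ _ (hφ x) hr hx)
    ne := fun he => h.ne (congrArg q (hq' _ _ hp hr he))
    mono := fun x y z w hxy hzw hl => hlt _ _ _ _ (hadj _ _ hxy) (hadj _ _ hzw) (hφ _) (hφ _)
      (hφ _) (hφ _) (h.mono x y z w hxy hzw hl)
    low := fun x y hxy => hlt _ _ _ _ (hpa a).symm (hadj _ _ hxy) hp (hφ _) (hφ _) (hφ _)
      (h.low x y hxy)
    high := fun x y hxy => hlt _ _ _ _ (hadj _ _ hxy) (hra b).symm (hφ _) (hφ _) hr (hφ _)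
      (h.high x y hxy) }

end Labelled
end EdgeOrderedGraph

namespace EdgeOrderedGraph

/-! ### Covering a prescribed vertex by a pendant copy -/

section Cover
variable {V : Type*} {W : Type}

/-- Some pendant copy contains `x` and otherwise only vertices among the first `n` terms of `q`. -/
def HasCover (G : SimpleGraph V) (l : V → V → ℤ) (a b : V) (c : W → W → ℤ) (q : ℕ → W) (n : ℕ)
    (x : W) : Prop :=
  ∃ (φ : V → W) (p r : W), IsPendantCopy G l a b c φ p r ∧ x ∈ pendantSupport φ p r ∧
    ∀ w ∈ pendantSupport φ p r, w = x ∨ ∃ i < n, w = q i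

variable {G : SimpleGraph V} {l : V → V → ℤ} {a b : V} {t : ℕ} {c : W → W → ℤ}

theorem HasCover.of_neg {q : ℕ → W} {n : ℕ} {x : W}
    (h : HasCover G (fun x y => - l x y) b a (fun x y => - c x y) q n x) :
    HasCover G l a b c q n x := by
  obtain ⟨φ, p, r, h1, h2, h3⟩ := h
  refine ⟨φ, r, p, h1.of_neg, ?_, ?_⟩
  · rwa [pendantSupport, Set.insert_comm]
  · rwa [pendantSupport, Set.insert_comm]

theorem HasCover.of_subseq {q : ℕ → W} {n m : ℕ} {x : W} (s : ℕ → ℕ) (hs : ∀ i < n, s i < m)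
    (h : HasCover G l a b c (fun i => q (s i)) n x) : HasCover G l a b c q m x := by
  obtain ⟨φ, p, r, h1, h2, h3⟩ := h
  refine ⟨φ, p, r, h1, h2, fun w hw => (h3 w hw).imp id ?_⟩
  rintro ⟨i, hi, rfl⟩
  exact ⟨s i, hs i hi, rfl⟩

theorem HasCover.of_le {q : ℕ → W} {n m : ℕ} {x : W} (hnm : n ≤ m)
    (h : HasCover G l a b c q n x) : HasCover G l a b c q m x :=
  h.of_subseq id fun _ hi => lt_of_lt_of_le hi hnm

variable {q : ℕ → W} {n : ℕ} {x : W}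

theorem HasCover.of_low {φ : V → ℕ} {r : ℕ} (hq : ∀ i j, i < n → j < n → q i = q j → i = j)
    (hx : ∀ i < n, q i ≠ x) (hφ : Function.Injective φ) (hφn : ∀ y, φ y < n) (hr : r < n)
    (hφr : ∀ y, φ y ≠ r) (hm : IsMonotoneMap G l c (fun y => q (φ y)))
    (hlow : ∀ y z, G.Adj y z → c x (q (φ a)) < c (q (φ y)) (q (φ z)))
    (hhigh : ∀ y z, G.Adj y z → c (q (φ y)) (q (φ z)) < c (q r) (q (φ b))) :
    HasCover G l a b c q n x := by
  refine ⟨fun y => q (φ y), x, q r, ⟨fun y z h => hφ (hq _ _ (hφn y) (hφn z) h),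
    fun y => hx _ (hφn y), fun y h => hφr y (hq _ _ (hφn y) hr h), (hx r hr).symm, hm, hlow, hhigh⟩,
    Set.mem_insert _ _, ?_⟩
  rintro w (rfl | rfl | ⟨y, rfl⟩)
  · exact Or.inl rfl
  · exact Or.inr ⟨r, hr, rfl⟩
  · exact Or.inr ⟨φ y, hφn y, rfl⟩

theorem HasCover.of_high {φ : V → ℕ} {p : ℕ} (hq : ∀ i j, i < n → j < n → q i = q j → i = j)
    (hx : ∀ i < n, q i ≠ x) (hφ : Function.Injective φ) (hφn : ∀ y, φ y < n) (hp : p < n)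
    (hφp : ∀ y, φ y ≠ p) (hm : IsMonotoneMap G l c (fun y => q (φ y)))
    (hlow : ∀ y z, G.Adj y z → c (q p) (q (φ a)) < c (q (φ y)) (q (φ z)))
    (hhigh : ∀ y z, G.Adj y z → c (q (φ y)) (q (φ z)) < c x (q (φ b))) :
    HasCover G l a b c q n x := by
  refine ⟨fun y => q (φ y), q p, x, ⟨fun y z h => hφ (hq _ _ (hφn y) (hφn z) h),
    fun y h => hφp y (hq _ _ (hφn y) hp h), fun y => hx _ (hφn y), hx p hp, hm, hlow, hhigh⟩,
    Set.mem_insert_of_mem _ (Set.mem_insert _ _), ?_⟩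
  rintro w (rfl | rfl | ⟨y, rfl⟩)
  · exact Or.inr ⟨p, hp, rfl⟩
  · exact Or.inl rfl
  · exact Or.inr ⟨φ y, hφn y, rfl⟩

/-- The vertex `x` lies below the whole lexicographic sequence. -/
theorem IsSeed.hasCover_of_below (hl : IsSeed G l a b t) (hc : IsLabelling c)
    (hq : ∀ i j, i < n → j < n → q i = q j → i = j) (hx : ∀ i < n, q i ≠ x) (h : IsLex c q n)
    (hn : 5 * (t + 1) ≤ n)
    (hP : ∀ i j k, i < j → j < k → k < n → c x (q k) < c (q i) (q j)) :
    HasCover G l a b c q n x := by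
  -- The offset keeps the terms 0 and 1 before the copy: their edge lies above the edge from `x` to
  -- the image of `a` and below all edges of the copy.
  obtain ⟨φ, h1, h2, h3, h5, h4⟩ := hl.exists_spread (o := 1) hc hq hn
  have h3' : ∀ x, φ x + 2 < n := fun x => (h3 x).trans_le hn
  obtain ⟨r, hr, hr5, hrh⟩ := hl.exists_high hc h h1 h2 h3' h4
  refine HasCover.of_low hq hx h1 (fun y => by have := h3' y; omega) hr
    (fun y => by have := h2 y; omega) h4 (fun y z hyz => ?_) hrh
  have ha := h3' a
  have ha5 := h5 a
  have hne : φ y ≠ φ z := fun he => hyz.ne (h1 he)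
  have hy := h3' y
  have hz := h3' z
  have hy5 := h5 y
  have hz5 := h5 z
  refine (hP 0 1 (φ a) (by omega) (by omega) (by omega)).trans ?_
  rcases lt_or_gt_of_ne hne with hlt | hlt
  · exact h.block _ _ _ _ (by omega) hlt (by omega) (by omega) (by omega)
  · rw [hc.symm (q (φ y))]
    exact h.block _ _ _ _ (by omega) hlt (by omega) (by omega) (by omega)

/-- The vertex `x` lies above the whole lexicographic sequence. -/
theorem IsSeed.hasCover_of_above (hl : IsSeed G l a b t) (hc : IsLabelling c)
    (hq : ∀ i j, i < n → j < n → q i = q j → i = j) (hx : ∀ i < n, q i ≠ x) (h : IsLex c q n)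
    (hn : 5 * (t + 1) ≤ n)
    (hP : ∀ i j k, i < j → j < k → k < n → c (q j) (q k) < c x (q i)) :
    HasCover G l a b c q n x := by
  obtain ⟨φ, h1, h2, h3, -, h4⟩ := hl.exists_spread (o := 0) (n := n) hc hq (by omega)
  have h3' : ∀ x, φ x + 2 < n := fun x => (h3 x).trans_le (by omega)
  obtain ⟨p, hp, hp5, hpl⟩ := hl.exists_low hc h h1 h2 h3' h4
  refine HasCover.of_high hq hx h1 (fun y => by have := h3' y; omega) hp
    (fun y => by have := h2 y; omega) h4 hpl (fun y z hyz => ?_)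
  have hb := h3 b
  have hne : φ y ≠ φ z := fun he => hyz.ne (h1 he)
  have hy := h3 y
  have hz := h3 z
  -- The edge of the last two terms separates: the copy lies before both, and the edge from `x` to
  -- the image of `b` is larger still.
  refine lt_trans ?_ (hP (φ b) (n - 2) (n - 1) (by omega) (by omega) (by omega))
  rcases lt_or_gt_of_ne hne with hlt | hlt
  · exact h.block _ _ _ _ hlt (by omega) (by omega) (by omega) (by omega)
  · rw [hc.symm (q (φ y))]
    exact h.block _ _ _ _ hlt (by omega) (by omega) (by omega) (by omega)

/-- Each edge from `x` to a term `q i` lies above the edges from `q i` to later terms. -/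
theorem IsSeed.hasCover_of_row_lt (hl : IsSeed G l a b t) (hc : IsLabelling c)
    (hq : ∀ i j, i < n → j < n → q i = q j → i = j) (hx : ∀ i < n, q i ≠ x) (h : IsLex c q n)
    (hn : 5 * (t + 1) ≤ n)
    (hP : ∀ i j k, j ≤ i → j < k → i < n → k < n → c (q j) (q k) < c x (q i)) :
    HasCover G l a b c q n x := by
  obtain ⟨φ, h1, h2, h3, -, h4⟩ := hl.exists_spread (o := 0) (n := n) hc hq (by omega)
  have h3' : ∀ x, φ x + 2 < n := fun x => (h3 x).trans_le (by omega)
  obtain ⟨p, hp, hp5, hpl⟩ := hl.exists_low hc h h1 h2 h3' h4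
  refine HasCover.of_high hq hx h1 (fun y => by have := h3' y; omega) hp
    (fun y => by have := h2 y; omega) h4 hpl (fun y z hyz => ?_)
  obtain ⟨w, hbw, hw⟩ := hl.high
  -- It suffices to beat the largest edge `bw`, which lies in the row of the image of `b` or in an
  -- earlier one.
  refine (h4.le_of_le hl hc hyz hbw (hw y z hyz)).trans_lt ?_
  have hb := h3' b
  have hw := h3' w
  have hne : φ b ≠ φ w := fun he => hbw.ne (h1 he)
  rcases lt_or_gt_of_ne hne with hlt | hlt
  · exact hP _ _ _ le_rfl hlt (by omega) (by omega)
  · rw [hc.symm (q (φ b))]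
    exact hP _ _ _ hlt.le hlt (by omega) (by omega)

/-- The rows increase and each edge from `x` to a term `q i` lies just below the row of `q i`. -/
theorem IsSeed.hasCover_of_lt_row_inc (hl : IsSeed G l a b t) (hc : IsLabelling c)
    (hq : ∀ i j, i < n → j < n → q i = q j → i = j) (hx : ∀ i < n, q i ≠ x) (h : IsLex c q n)
    (hn : 5 * (t + 1) ≤ n)
    (hr : ∀ i j k, i < j → j < k → k < n → c (q i) (q j) < c (q i) (q k))
    (hP : ∀ i j k, i ≤ j → j < k → k < n → c x (q i) < c (q j) (q k)) :
    HasCover G l a b c q n x := by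
  obtain ⟨φ, h1, h2, h3, h4⟩ := hl.first
  have hne : ∀ y z, G.Adj y z → φ y ≠ φ z := fun y z hyz he => hyz.ne (h1 he)
  -- Increasing rows realise the min ordering, so the map from `hl.first` gives a copy directly.
  -- Since `a` comes first in it, every edge of the copy lies in the row of the image of `a` or in a
  -- later row, hence above the edge from `x` to that image.
  have hm : IsMonotoneMap G l c (fun y => q (5 * φ y + 2)) := by
    intro y z y' z' hyz hyz' hlt
    have := hne _ _ hyz
    have := hne _ _ hyz'
    have := h2 y
    have := h2 z
    have := h2 y'
    have := h2 z'
    have := h4 y z y' z' hyz hyz' hlt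
    refine h.lt_of_inc hc hr ?_ ?_ ?_ ?_ ?_ ?_ ?_ <;> omega
  have hn' : ∀ y, 5 * φ y + 2 + 2 < n := fun y => by have := h2 y; omega
  have hinj : Function.Injective (fun y => 5 * φ y + 2) := fun y z hyz =>
    h1 (by simp only at hyz; omega)
  obtain ⟨r, hrn, hr5, hrh⟩ := hl.exists_high hc h hinj (fun y => by omega) hn' hm
  refine HasCover.of_low hq hx hinj (fun y => by have := hn' y; omega) hrn
    (fun y => by omega) hm (fun y z hyz => ?_) hrh
  have hy := hn' y
  have hz := hn' z
  have := hne _ _ hyz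
  simp only [h3]
  rcases lt_or_gt_of_ne (hne _ _ hyz) with hlt | hlt
  · exact hP _ _ _ (by omega) (by omega) (by omega)
  · rw [hc.symm (q (5 * φ y + 2))]
    exact hP _ _ _ (by omega) (by omega) (by omega)

/-- The rows decrease and `x` behaves like a term after all others. -/
theorem IsSeed.hasCover_of_lt_row_dec [Finite V] (hl : IsSeed G l a b t) (hc : IsLabelling c)
    (hq : ∀ i j, i < n → j < n → q i = q j → i = j) (hx : ∀ i < n, q i ≠ x) (h : IsLex c q n)
    (hn : 5 * (t + 1) ≤ n)
    (hr : ∀ i j k, i < j → j < k → k < n → c (q i) (q k) < c (q i) (q j))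
    (hP : ∀ i j k, i ≤ j → j < k → k < n → c x (q i) < c (q j) (q k))
    (hP' : ∀ i j k, j < i → j < k → i < n → k < n → c (q j) (q k) < c x (q i)) :
    HasCover G l a b c q n x := by
  obtain ⟨φ, p, r, hφn, hpn, hrn, hcopy⟩ := hl.exists_copy_of_isLex hc hq h (by omega)
  -- Here `y` is the last position used by the copy, counting the pendant vertices; it is the
  -- position handed over to `x`.
  obtain ⟨y, hy, hmax⟩ := Set.exists_max_image (pendantSupport φ p r) id
    (((Set.finite_range φ).insert r).insert p) ⟨p, Set.mem_insert _ _⟩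
  simp only [id] at hmax
  have hpy : p ≤ y := hmax _ (Set.mem_insert _ _)
  have hry : r ≤ y := hmax _ (Set.mem_insert_of_mem _ (Set.mem_insert _ _))
  have hφy : ∀ z, φ z ≤ y := fun z =>
    hmax _ (Set.mem_insert_of_mem _ (Set.mem_insert_of_mem _ ⟨z, rfl⟩))
  have hyn : y < n := by
    rcases hy with rfl | rfl | ⟨z, rfl⟩
    · exact hpn
    · exact hrn
    · exact hφn z
  let q' : ℕ → W := fun i => if i < y then q i else x
  have hlt' : ∀ i, i < y → q' i = q i := fun i hi => by simp [q', hi]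
  have hqy : q' y = x := by simp [q']
  have hq' : ∀ i j, i < y + 1 → j < y + 1 → q' i = q' j → i = j := by
    intro i j hi hj hij
    rcases (Nat.lt_succ_iff_lt_or_eq.1 hi) with hi | rfl <;>
      rcases (Nat.lt_succ_iff_lt_or_eq.1 hj) with hj | rfl
    · rw [hlt' _ hi, hlt' _ hj] at hij
      exact hq _ _ (by omega) (by omega) hij
    · rw [hlt' _ hi, hqy] at hij
      exact absurd hij (hx _ (by omega))
    · rw [hlt' _ hj, hqy] at hij
      exact absurd hij.symm (hx _ (by omega))
    · rfl
  have hlex : IsLex c q (y + 1) := h.of_le (by omega)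
  have hr' : ∀ i j k, i < j → j < k → k < y + 1 → c (q' i) (q' k) < c (q' i) (q' j) := by
    intro i j k hij hjk hk
    rw [hlt' i (by omega), hlt' j (by omega)]
    rcases (Nat.lt_succ_iff_lt_or_eq.1 hk) with hk | rfl
    · rw [hlt' k hk]
      exact hr _ _ _ hij hjk (by omega)
    · rw [hqy, hc.symm]
      exact hP _ _ _ le_rfl hij (by omega)
  have hlex' : IsLex c q' (y + 1) := by
    refine ⟨fun i j k m hij hkm hj hm hik => ?_, Or.inr hr'⟩
    rw [hlt' i (by omega), hlt' k (by omega)]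
    rcases (Nat.lt_succ_iff_lt_or_eq.1 hj) with hj | rfl <;>
      rcases (Nat.lt_succ_iff_lt_or_eq.1 hm) with hm | rfl
    · rw [hlt' _ hj, hlt' _ hm]
      exact h.block _ _ _ _ hij hkm (by omega) (by omega) hik
    · rw [hlt' _ hj, hqy, hc.symm (q k)]
      exact hP' _ _ _ hik hij (by omega) (by omega)
    · rw [hlt' _ hm, hqy, hc.symm (q i)]
      exact hP _ _ _ hik.le hkm (by omega)
    · rw [hqy, hc.symm (q i), hc.symm (q k)]
      exact (hP i i k le_rfl hik (by omega)).trans (hP' k i k hik hik (by omega) (by omega))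
  have hcopy' := hcopy.transfer (q' := q') (n := y + 1) (fun z => Nat.lt_succ_of_le (hφy z))
    (Nat.lt_succ_of_le hpy) (Nat.lt_succ_of_le hry) hq'
    (fun i j k m hij hkm hi hj hk hm hlt =>
      (hlex'.lt_iff_of_dec hc hr' hij hkm hi hj hk hm).2
        ((hlex.lt_iff_of_dec hc (fun i j k hij hjk hk => hr i j k hij hjk (by omega))
          hij hkm hi hj hk hm).1 hlt))
  have hmem : ∀ i ≤ y, q' i = x ∨ ∃ j < n, q' i = q j := by
    intro i hi
    rcases hi.lt_or_eq with hi | rfl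
    · exact Or.inr ⟨i, by omega, hlt' i hi⟩
    · exact Or.inl hqy
  refine ⟨_, _, _, hcopy', ?_, ?_⟩
  · rw [← hqy]
    rcases hy with hy | hy | ⟨z, hy⟩
    · rw [hy]; exact Set.mem_insert _ _
    · rw [hy]; exact Set.mem_insert_of_mem _ (Set.mem_insert _ _)
    · exact Set.mem_insert_of_mem _ (Set.mem_insert_of_mem _ ⟨z, by simp only [hy]⟩)
  · rintro w (rfl | rfl | ⟨z, rfl⟩)
    · exact hmem _ hpy
    · exact hmem _ hry
    · exact hmem _ (hφy z)

/-- The bound `N` is fixed before `l`, `a` and `b`, so that one value serves both a seed and its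
negation. -/
theorem IsSeed.exists_hasCover_of_isLex [Finite V] (G : SimpleGraph V) (t : ℕ) :
    ∃ N : ℕ, ∀ (l : V → V → ℤ) (a b : V), IsSeed G l a b t →
    ∀ {W : Type} (c : W → W → ℤ), IsLabelling c → ∀ q : ℕ → W,
    (∀ i j, i < N → j < N → q i = q j → i = j) → ∀ x, (∀ i < N, q i ≠ x) → IsLex c q N →
    HasCover G l a b c q N x := by
  set m := 5 * (t + 1) with hm
  obtain ⟨N, hN⟩ := exists_homogeneous_subseq (Fin 3) (3 * m + 2)
  refine ⟨N, fun l a b hl {W} c hc q hq x hx h => ?_⟩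
  -- The predicates compare the edge from `x` to a term with an edge between earlier terms, an edge
  -- between later terms, and an edge in the row of that term.
  obtain ⟨s, hs, hsN, hP⟩ := hN ![fun i j k _ => c x (q k) < c (q i) (q j),
    fun i j k _ => c x (q i) < c (q j) (q k),
    fun i j k _ => c x (q i) < c (q i) (q j)]
  refine HasCover.of_subseq (n := 3 * m + 2) s hsN ?_
  set p : ℕ → W := fun i => q (s i) with hp
  have hpi : ∀ i j, i < 3 * m + 2 → j < 3 * m + 2 → p i = p j → i = j := fun i j hi hj h =>
    hs.injective (hq _ _ (hsN i hi) (hsN j hj) h)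
  have hpx : ∀ i < 3 * m + 2, p i ≠ x := fun i hi => hx _ (hsN i hi)
  have hlex : IsLex c p (3 * m + 2) := h.mono s hs hsN
  have hlt : ∀ i j k, i < j → j < 3 * m + 2 → k < 3 * m + 2 →
      ¬ c x (p k) < c (p i) (p j) → c (p i) (p j) < c x (p k) := by
    intro i j k hij hj hk h
    refine (hc.lt_or_gt (hpx k hk).symm ?_ ?_).resolve_left h
    · exact fun h => absurd (hpi i j (by omega) hj h) (by omega)
    · intro h
      rcases Sym2.eq_iff.1 h with ⟨h1, -⟩ | ⟨h1, -⟩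
      · exact hpx _ (by omega) h1.symm
      · exact hpx _ (by omega) h1.symm
  rcases hP 0 with h0 | h0
  · exact HasCover.of_le (n := m) (by omega)
      (hl.hasCover_of_below hc (fun i j hi hj => hpi i j (by omega) (by omega))
        (fun i hi => hpx i (by omega))
        (hlex.of_le (by omega)) le_rfl
        (fun i j k hij hjk hk => h0 i j k (k + 1) hij hjk (by omega) (by omega)))
  rcases hP 1 with h1 | h1
  swap
  · exact HasCover.of_le (n := m) (by omega)
      (hl.hasCover_of_above hc (fun i j hi hj => hpi i j (by omega) (by omega))
        (fun i hi => hpx i (by omega))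
        (hlex.of_le (by omega)) le_rfl
        (fun i j k hij hjk hk => hlt _ _ _ hjk (by omega) (by omega)
          (h1 i j k (k + 1) hij hjk (by omega) (by omega))))
  -- Passing to every third term leaves an edge from `3 * j + 1` to `3 * j + 2`. It lies above the
  -- whole row of `3 * j`, and for `j < i` both its ends precede `3 * i`, so it bounds that row
  -- below the edge from `x` to `p (3 * i)`, even when the row's edge ends beyond `3 * i`.
  have hs3 : StrictMono (fun i : ℕ => 3 * i) := fun i j hij => by simp only; omega
  have hlex3 : IsLex c (fun i => p (3 * i)) m := hlex.mono _ hs3 (fun i hi => by omega)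
  refine HasCover.of_subseq (n := m) (fun i => 3 * i) (fun i hi => by omega) ?_
  have hpi3 : ∀ i j, i < m → j < m → p (3 * i) = p (3 * j) → i = j := fun i j hi hj h => by
    have := hpi _ _ (by omega) (by omega) h
    omega
  have hpx3 : ∀ i < m, p (3 * i) ≠ x := fun i hi => hpx _ (by omega)
  have habove : ∀ i j k, j < i → j < k → i < m → k < m →
      c (p (3 * j)) (p (3 * k)) < c x (p (3 * i)) := by
    intro i j k hji hjk hi hk
    refine (hlex.block (3 * j) (3 * k) (3 * j + 1) (3 * j + 2) (by omega) (by omega) (by omega)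
      (by omega) (by omega)).trans (hlt _ _ _ (by omega) (by omega) (by omega)
        (h0 _ _ _ (3 * i + 1) (by omega) (by omega) (by omega) (by omega)))
  have hbelow : ∀ i j k, i < j → j < k → k < m →
      c x (p (3 * i)) < c (p (3 * j)) (p (3 * k)) := fun i j k hij hjk hk =>
    h1 _ _ _ (3 * k + 1) (by omega) (by omega) (by omega) (by omega)
  rcases hP 2 with h2 | h2
  · have hle : ∀ i j k, i ≤ j → j < k → k < m → c x (p (3 * i)) < c (p (3 * j)) (p (3 * k)) := by
      intro i j k hij hjk hk
      rcases hij.lt_or_eq with hij | rfl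
      · exact hbelow _ _ _ hij hjk hk
      · exact h2 _ _ (3 * k + 1) (3 * k + 2) (by omega) (by omega) (by omega) (by omega)
    rcases hlex3.row with hr | hr
    · exact hl.hasCover_of_lt_row_inc hc hpi3 hpx3 hlex3 le_rfl hr hle
    · exact hl.hasCover_of_lt_row_dec hc hpi3 hpx3 hlex3 le_rfl hr hle habove
  · refine hl.hasCover_of_row_lt hc hpi3 hpx3 hlex3 le_rfl fun i j k hji hjk hi hk => ?_
    rcases hji.lt_or_eq with hji | rfl
    · exact habove _ _ _ hji hjk hi hk
    · exact hlt _ _ _ (by omega) (by omega) (by omega) (h2 _ _ (3 * k + 1) (3 * k + 2) (by omega)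
        (by omega) (by omega) (by omega))

/-- Every vertex together with a long sequence of other vertices contains a pendant copy through
that vertex. -/
theorem IsSeed.exists_hasCover [Finite V] (hl : IsSeed G l a b t) :
    ∃ N : ℕ, ∀ {W : Type} (c : W → W → ℤ), IsLabelling c → ∀ q : ℕ → W,
    (∀ i j, i < N → j < N → q i = q j → i = j) → ∀ x, (∀ i < N, q i ≠ x) →
    HasCover G l a b c q N x := by
  obtain ⟨n, hn⟩ := IsSeed.exists_hasCover_of_isLex G t
  obtain ⟨N, hN⟩ := exists_isLex n
  refine ⟨N, fun {W} c hc q hq x hx => ?_⟩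
  obtain ⟨r, hr, hri, hlex⟩ := hN c hc q hq
  have hi : ∀ i j, i < n → j < n → q (r i) = q (r j) → i = j := fun i j hi hj h =>
    hri i j hi hj (hq _ _ (hr i hi) (hr j hj) h)
  have hx' : ∀ i < n, q (r i) ≠ x := fun i hi => hx _ (hr i hi)
  refine HasCover.of_subseq (n := n) r hr ?_
  rcases hlex with h | h
  · exact hn l a b hl c hc _ hi x hx' h
  · exact HasCover.of_neg (hn _ b a hl.neg _ hc.neg _ hi x hx' h)

end Cover
end EdgeOrderedGraph

namespace EdgeOrderedGraph

/-! ### From covering to perfect tilings -/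

section Tiling
variable {α : Type*} [DecidableEq α]

/-- `X` is a disjoint union of members of `𝓕`. -/
def IsTiled (𝓕 : Set (Finset α)) (X : Finset α) : Prop :=
  ∃ P : Set (Finset α), P ⊆ 𝓕 ∧ P.PairwiseDisjoint id ∧ ∀ x, x ∈ X ↔ ∃ A ∈ P, x ∈ A

variable {𝓕 : Set (Finset α)}

theorem IsTiled.of_sdiff {A X : Finset α} (hA : A ∈ 𝓕) (hAX : A ⊆ X) (h : IsTiled 𝓕 (X \ A)) :
    IsTiled 𝓕 X := by
  obtain ⟨P, h1, h2, h3⟩ := h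
  refine ⟨insert A P, Set.insert_subset hA h1, h2.insert fun B hB _ => ?_, fun x => ?_⟩
  · refine Finset.disjoint_left.2 fun x hxA hxB => ?_
    exact (Finset.mem_sdiff.1 ((h3 x).2 ⟨B, hB, hxB⟩)).2 hxA
  · have := h3 x
    rw [Finset.mem_sdiff] at this
    rw [Set.exists_mem_insert, ← this]
    by_cases hx : x ∈ A
    · simp [hx, hAX hx]
    · simp [hx]

theorem isTiled_of_homogeneous {k : ℕ} (hk : 0 < k) {Q : Finset α}
    (hQ : ∀ A ⊆ Q, A.card = k → A ∈ 𝓕) (hd : k ∣ Q.card) : IsTiled 𝓕 Q := by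
  induction hn : Q.card using Nat.strong_induction_on generalizing Q with
  | _ n ih =>
  rcases Nat.eq_zero_or_pos n with rfl | hpos
  · rw [Finset.card_eq_zero.1 hn]
    exact ⟨∅, by simp, by simp, by simp⟩
  · have hkn : k ≤ Q.card := Nat.le_of_dvd (hn ▸ hpos) hd
    obtain ⟨A, hAQ, hA⟩ := Finset.exists_subset_card_eq hkn
    have hc : (Q \ A).card = Q.card - k := by rw [Finset.card_sdiff_of_subset hAQ, hA]
    exact IsTiled.of_sdiff (hQ A hAQ hA) hAQ (ih (Q \ A).card (by omega)
      (fun B hB => hQ B (hB.trans Finset.sdiff_subset))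
      (by rw [hc]; exact Nat.dvd_sub hd dvd_rfl) rfl)

variable {k M : ℕ} {Q : Finset α}

/-- Each vertex of `U` is covered using vertices of `S` only. This costs at most `k` of them, so `S`
stays large enough throughout, and the rest of `S` is homogeneous. -/
theorem isTiled_of_absorb (hk : 0 < k) (hQ : ∀ A ⊆ Q, A.card = k → A ∈ 𝓕)
    (hcard : ∀ A ∈ 𝓕, A.card = k)
    (hcov : ∀ (x : α) (S : Finset α), x ∉ S → M ≤ S.card → ∃ A ∈ 𝓕, x ∈ A ∧ A ⊆ insert x S)
    (U S : Finset α) (hS : S ⊆ Q) (hUS : Disjoint U S) (hd : k ∣ (U ∪ S).card)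
    (hM : M + k * U.card ≤ S.card) : IsTiled 𝓕 (U ∪ S) := by
  induction U using Finset.induction_on generalizing S with
  | empty =>
    rw [Finset.empty_union] at hd ⊢
    exact isTiled_of_homogeneous hk (fun A hA => hQ A (hA.trans hS)) hd
  | insert x U hxU ih =>
    rw [Finset.disjoint_insert_left] at hUS
    obtain ⟨A, hA, hxA, hAS⟩ := hcov x S hUS.1 (by omega)
    have hAU : A ⊆ insert x U ∪ S :=
      hAS.trans (Finset.insert_subset (by simp) Finset.subset_union_right)
    have hset : (insert x U ∪ S) \ A = U ∪ S \ A := by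
      ext y
      have h1 : y ∈ A → y ∈ U → False := fun h1 h2 => by
        rcases Finset.mem_insert.1 (hAS h1) with rfl | h3
        · exact hxU h2
        · exact Finset.disjoint_left.1 hUS.2 h2 h3
      simp only [Finset.mem_sdiff, Finset.mem_union, Finset.mem_insert]
      constructor
      · rintro ⟨(rfl | h) | h, h'⟩
        · exact absurd hxA h'
        · exact Or.inl h
        · exact Or.inr ⟨h, h'⟩
      · rintro (h | ⟨h, h'⟩)
        · exact ⟨Or.inl (Or.inr h), fun h2 => h1 h2 h⟩
        · exact ⟨Or.inr h, h'⟩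
    refine IsTiled.of_sdiff hA hAU ?_
    have hc := Finset.card_sdiff_of_subset hAU
    rw [hcard A hA] at hc
    rw [hset] at hc ⊢
    refine ih (S \ A) (Finset.sdiff_subset.trans hS) (hUS.2.mono_right Finset.sdiff_subset)
      (by rw [hc]; exact Nat.dvd_sub hd dvd_rfl) ?_
    have h2 := Finset.le_card_sdiff A S
    rw [hcard A hA] at h2
    rw [Finset.card_insert_of_notMem hxU, mul_add] at hM
    omega

/-- While `U` has more than `M` vertices, a member of `𝓕` is found inside `U` itself, leaving `Q`
intact; the at most `M` leftover vertices are absorbed by `Q`. -/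
theorem isTiled_of_cover (hk : 0 < k) (hQ : ∀ A ⊆ Q, A.card = k → A ∈ 𝓕)
    (hcard : ∀ A ∈ 𝓕, A.card = k)
    (hcov : ∀ (x : α) (S : Finset α), x ∉ S → M ≤ S.card → ∃ A ∈ 𝓕, x ∈ A ∧ A ⊆ insert x S)
    (hM : M + k * M ≤ Q.card) (U : Finset α) (hUQ : Disjoint U Q)
    (hd : k ∣ (U ∪ Q).card) : IsTiled 𝓕 (U ∪ Q) := by
  induction hn : U.card using Nat.strong_induction_on generalizing U with
  | _ n ih =>
  rcases le_or_gt n M with hnM | hnM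
  · refine isTiled_of_absorb hk hQ hcard hcov U Q subset_rfl hUQ hd ?_
    have := Nat.mul_le_mul_left k (hn.trans_le hnM)
    omega
  · obtain ⟨x, hx⟩ : U.Nonempty := Finset.card_pos.1 (by omega)
    obtain ⟨A, hA, hxA, hAU⟩ := hcov x (U.erase x) (Finset.notMem_erase x U)
      (by rw [Finset.card_erase_of_mem hx]; omega)
    rw [Finset.insert_erase hx] at hAU
    have hAU' : A ⊆ U ∪ Q := hAU.trans Finset.subset_union_left
    have hset : (U ∪ Q) \ A = U \ A ∪ Q := by
      rw [Finset.union_sdiff_distrib,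
        Finset.sdiff_eq_self_of_disjoint (hUQ.mono_left hAU).symm]
    refine IsTiled.of_sdiff hA hAU' ?_
    have hc := Finset.card_sdiff_of_subset hAU'
    have hc' := Finset.card_sdiff_of_subset hAU
    have hAU2 := Finset.card_le_card hAU
    rw [hcard A hA] at hc hc' hAU2
    rw [hset] at hc ⊢
    exact ih (U \ A).card (by omega) (U \ A) (hUQ.mono_left Finset.sdiff_subset)
      (by rw [hc]; exact Nat.dvd_sub hd dvd_rfl) rfl

/-- If every vertex is covered by a member of `𝓕` inside any large set, then a large finite type of
divisible cardinality is tiled by `𝓕`. -/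
theorem exists_isTiled_univ (k M : ℕ) (hk : 0 < k) :
    ∃ t : ℕ, 0 < t ∧ k ∣ t ∧ ∀ 𝓕 : Set (Finset (Fin t)), (∀ A ∈ 𝓕, A.card = k) →
      (∀ (x : Fin t) (S : Finset (Fin t)), x ∉ S → M ≤ S.card →
        ∃ A ∈ 𝓕, x ∈ A ∧ A ⊆ insert x S) → IsTiled 𝓕 Finset.univ := by
  -- The type `Fin t` depends on `N`, so Ramsey's theorem is used on `ℕ` and the family is
  -- transported along `Fin.valEmbedding`. The extra 1 in the size allows one vertex of `Q` to be
  -- singled out and covered from the others.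
  obtain ⟨N, hN⟩ := finset_ramsey (α := ℕ) (κ := Prop) k (fun _ => M + k * M + 1)
  refine ⟨k * (N + 1), by positivity, dvd_mul_right _ _, fun 𝓕 hcard hcov => ?_⟩
  have hNt : N ≤ k * (N + 1) := by nlinarith
  obtain ⟨col, T, hTS, hTc, hT⟩ := hN (Finset.range (k * (N + 1))) (by simpa using hNt)
    (fun A => ∃ B ∈ 𝓕, B.map Fin.valEmbedding = A)
  let Q : Finset (Fin (k * (N + 1))) := Finset.univ.filter fun x => (x : ℕ) ∈ T
  have hQT : Q.map Fin.valEmbedding = T := by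
    ext y
    simp only [Q, Finset.mem_map, Finset.mem_filter, Finset.mem_univ, true_and,
      Fin.valEmbedding_apply]
    constructor
    · rintro ⟨x, hx, rfl⟩
      exact hx
    · exact fun hy => ⟨⟨y, Finset.mem_range.1 (hTS hy)⟩, hy, rfl⟩
  have hQc : Q.card = M + k * M + 1 := by rw [← hTc, ← hQT, Finset.card_map]
  have hhom : ∀ A ⊆ Q, A.card = k → (A ∈ 𝓕 ↔ col) := by
    intro A hA hAc
    rw [← hT (A.map Fin.valEmbedding) (by rw [← hQT]; exact Finset.map_subset_map.2 hA)
      (by rw [Finset.card_map, hAc])]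
    constructor
    · exact fun h => ⟨A, h, rfl⟩
    · rintro ⟨B, hB, hBA⟩
      rwa [← Finset.map_injective _ hBA]
  -- Covering a vertex of `Q` from within `Q` yields one member of `𝓕`, which rules out the negative
  -- colour.
  have hcol : col := by
    obtain ⟨x, hx⟩ : Q.Nonempty := Finset.card_pos.1 (by omega)
    obtain ⟨A, hA, -, hAQ⟩ := hcov x (Q.erase x) (Finset.notMem_erase x Q)
      (by rw [Finset.card_erase_of_mem hx]; omega)
    rw [Finset.insert_erase hx] at hAQ
    exact (hhom A hAQ (hcard A hA)).1 hA
  have huniv : Finset.univ \ Q ∪ Q = Finset.univ :=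
    Finset.sdiff_union_of_subset (Finset.subset_univ Q)
  rw [← huniv]
  refine isTiled_of_cover hk (fun A hA hAc => (hhom A hA hAc).2 hcol) hcard hcov (by omega) _
    Finset.sdiff_disjoint ?_
  rw [huniv, Finset.card_univ, Fintype.card_fin]
  exact dvd_mul_right _ _

end Tiling

/-! ### Translation between edge-orders and integer labels -/

section Translation

universe u v

theorem exists_int_lt_iff_lt (α : Type*) [LinearOrder α] [Finite α] :
    ∃ f : α → ℤ, ∀ x y, x < y ↔ f x < f y := by
  have := Fintype.ofFinite α
  refine ⟨fun x => ((Fintype.orderIsoFinOfCardEq α rfl).symm x : ℕ), fun x y => ?_⟩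
  rw [Nat.cast_lt, Fin.val_fin_lt, OrderIso.lt_iff_lt]

/-- The edges of a finite edge-ordered graph can be labelled increasingly by integers. -/
theorem exists_edgeLabel {V : Type u} [Finite V] (H : EdgeOrderedGraph V) :
    ∃ L : Sym2 V → ℤ, ∀ e e' : H.graph.edgeSet, H.EdgeLT e e' ↔ L e.1 < L e'.1 := by
  classical
  obtain ⟨f, hf⟩ := @exists_int_lt_iff_lt H.graph.edgeSet H.edgeOrder _
  refine ⟨fun e => if h : e ∈ H.graph.edgeSet then f ⟨e, h⟩ else 0, fun e e' => ?_⟩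
  have he : e.1 ∈ H.graph.edgeSet := e.2
  have he' : e'.1 ∈ H.graph.edgeSet := e'.2
  simp only [he, he', dif_pos, Subtype.coe_eta]
  exact hf e e'

theorem edgeLabel_injOn {V : Type u} {H : EdgeOrderedGraph V} {L : Sym2 V → ℤ}
    (hL : ∀ e e' : H.graph.edgeSet, H.EdgeLT e e' ↔ L e.1 < L e'.1) {e e' : Sym2 V}
    (he : e ∈ H.graph.edgeSet) (he' : e' ∈ H.graph.edgeSet) (h : L e = L e') : e = e' := by
  let _ := H.edgeOrder
  rcases lt_trichotomy (⟨e, he⟩ : H.graph.edgeSet) ⟨e', he'⟩ with hlt | heq | hlt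
  · exact absurd ((hL _ _).1 hlt) (by simp [h])
  · exact congrArg Subtype.val heq
  · exact absurd ((hL _ _).1 hlt) (by simp [h])

theorem Embedding.isMonotoneMap {V : Type u} {W : Type} {F : EdgeOrderedGraph V}
    {H : EdgeOrderedGraph W} {L : Sym2 V → ℤ} {K : Sym2 W → ℤ}
    (hL : ∀ e e' : F.graph.edgeSet, F.EdgeLT e e' ↔ L e.1 < L e'.1)
    (hK : ∀ e e' : H.graph.edgeSet, H.EdgeLT e e' → K e.1 < K e'.1) (φ : Embedding F H) :
    IsMonotoneMap F.graph (fun x y => L s(x, y)) (fun x y => K s(x, y)) (fun x => φ.toCopy x) :=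
  fun x y z w hxy hzw hlt =>
    hK _ _ (φ.edgeLT_map ⟨s(x, y), hxy⟩ ⟨s(z, w), hzw⟩ ((hL _ _).2 hlt))

/-- The labels between the first `t` terms of `q` are distinct, so they define an edge-ordering of
`K_t` to which Turánability applies. -/
theorem Turanable.exists_monotoneMap {V : Type u} {F : EdgeOrderedGraph V} {L : Sym2 V → ℤ}
    (hL : ∀ e e' : F.graph.edgeSet, F.EdgeLT e e' ↔ L e.1 < L e'.1) (hF : F.Turanable) :
    ∃ t : ℕ, ∀ (W : Type) (c : W → W → ℤ), IsLabelling c → ∀ q : ℕ → W,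
    (∀ i j, i < t → j < t → q i = q j → i = j) → ∃ φ : V → ℕ, Function.Injective φ ∧
      (∀ x, φ x < t) ∧ IsMonotoneMap F.graph (fun x y => L s(x, y)) c (fun x => q (φ x)) := by
  obtain ⟨t, -, ht⟩ := hF
  refine ⟨t, fun W c hc q hq => ?_⟩
  let K : Sym2 (Fin t) → ℤ := Sym2.lift ⟨fun i j => c (q i) (q j), fun i j => hc.symm _ _⟩
  have hq' : ∀ i j : Fin t, q i = q j → i = j := fun i j h => Fin.ext (hq _ _ i.2 j.2 h)
  have hK : Function.Injective fun e : (⊤ : SimpleGraph (Fin t)).edgeSet => K e.1 := by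
    rintro ⟨e, he⟩ ⟨e', he'⟩ h
    refine Subtype.ext ?_
    induction e using Sym2.ind with
    | _ i j =>
    induction e' using Sym2.ind with
    | _ i' j' =>
    have hij : i ≠ j := by simpa using he
    have hij' : i' ≠ j' := by simpa using he'
    have := hc.inj _ _ _ _ (fun h => hij (hq' _ _ h)) (fun h => hij' (hq' _ _ h)) h
    rcases Sym2.eq_iff.1 this with ⟨h1, h2⟩ | ⟨h1, h2⟩
    · simp only [hq' _ _ h1, hq' _ _ h2]
    · simp only [hq' _ _ h1, hq' _ _ h2, Sym2.eq_swap]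
  obtain ⟨φ⟩ := ht (LinearOrder.lift' _ hK)
  refine ⟨fun x => (φ.toCopy x : Fin t), fun x y h => φ.toCopy.injective (Fin.ext h),
    fun x => (φ.toCopy x).2, fun x y z w hxy hzw hlt => ?_⟩
  exact Embedding.isMonotoneMap (H := complete t (LinearOrder.lift' _ hK)) hL (K := K)
    (fun e e' h => h) φ x y z w hxy hzw hlt

theorem lex_of_minLabel_lt {n : ℕ} {x y z w : Fin n}
    (h : minLabel n s(x, y) < minLabel n s(z, w)) :
    min (x : ℕ) y < min (z : ℕ) w ∨
      (min (x : ℕ) y = min (z : ℕ) w ∧ max (x : ℕ) y < max (z : ℕ) w) := by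
  simp only [minLabel, Sym2.inf_mk, Sym2.sup_mk] at h
  have h1 : ((max x y : Fin n) : ℕ) = max (x : ℕ) y := Fin.coe_max _ _
  have h2 : ((max z w : Fin n) : ℕ) = max (z : ℕ) w := Fin.coe_max _ _
  have h5 := (max x y).2
  have h6 := (max z w).2
  rw [← h1, ← h2, ← Fin.coe_min, ← Fin.coe_min]
  rcases lt_trichotomy ((min x y : Fin n) : ℕ) ((min z w : Fin n) : ℕ) with hlt | heq | hlt
  · exact Or.inl hlt
  · rw [heq] at h
    exact Or.inr ⟨heq, by omega⟩
  · exfalso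
    generalize ((max x y : Fin n) : ℕ) = A at hlt h h5 h6
    generalize ((max z w : Fin n) : ℕ) = B at hlt h h5 h6
    generalize ((min x y : Fin n) : ℕ) = C at hlt h h5 h6
    generalize ((min z w : Fin n) : ℕ) = D at hlt h h5 h6
    have h7 : (n : ℤ) * (D + 1) ≤ n * C := mul_le_mul_of_nonneg_left (by omega) (by omega)
    nlinarith

theorem colex_of_maxLabel_lt {n : ℕ} {x y z w : Fin n}
    (h : maxLabel n s(x, y) < maxLabel n s(z, w)) :
    max (x : ℕ) y < max (z : ℕ) w ∨
      (max (x : ℕ) y = max (z : ℕ) w ∧ min (x : ℕ) y < min (z : ℕ) w) := by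
  simp only [maxLabel, Sym2.inf_mk, Sym2.sup_mk] at h
  have h1 : ((max x y : Fin n) : ℕ) = max (x : ℕ) y := Fin.coe_max _ _
  have h2 : ((max z w : Fin n) : ℕ) = max (z : ℕ) w := Fin.coe_max _ _
  have h5 := (min x y).2
  have h6 := (min z w).2
  rw [← h1, ← h2, ← Fin.coe_min, ← Fin.coe_min]
  rcases lt_trichotomy ((max x y : Fin n) : ℕ) ((max z w : Fin n) : ℕ) with hlt | heq | hlt
  · exact Or.inl hlt
  · rw [heq] at h
    exact Or.inr ⟨heq, by omega⟩
  · exfalso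
    generalize ((max x y : Fin n) : ℕ) = A at hlt h h5 h6
    generalize ((max z w : Fin n) : ℕ) = B at hlt h h5 h6
    generalize ((min x y : Fin n) : ℕ) = C at hlt h h5 h6
    generalize ((min z w : Fin n) : ℕ) = D at hlt h h5 h6
    have h7 : (n : ℤ) * (B + 1) ≤ n * A := mul_le_mul_of_nonneg_left (by omega) (by omega)
    nlinarith

theorem IsMinimalVertex.hasLexMap {V : Type u} [Fintype V] {F : EdgeOrderedGraph V}
    {L : Sym2 V → ℤ} (hL : ∀ e e' : F.graph.edgeSet, F.EdgeLT e e' ↔ L e.1 < L e'.1) {a : V}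
    (ha : F.IsMinimalVertex a) {t : ℕ} (ht : Fintype.card V ≤ t) :
    HasLexMap F.graph (fun x y => L s(x, y)) a t := by
  obtain ⟨φ, hφ⟩ := ha
  exact ⟨fun x => (φ.toCopy x).val, fun x y h => φ.toCopy.injective (Fin.ext h),
    fun x => (φ.toCopy x).2.trans_le ht, hφ, fun x y z w hxy hzw hlt =>
    lex_of_minLabel_lt (Embedding.isMonotoneMap (H := minOrdering (Fintype.card V)) hL
      (K := minLabel _) (fun e e' h => h) φ x y z w hxy hzw hlt)⟩

/-- Reversing the vertices and the edge order turns the max ordering into the min ordering, and the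
last vertex into the first. -/
theorem IsMaximalVertex.hasLexMap {V : Type u} [Fintype V] {F : EdgeOrderedGraph V}
    {L : Sym2 V → ℤ} (hL : ∀ e e' : F.graph.edgeSet, F.EdgeLT e e' ↔ L e.1 < L e'.1) {b : V}
    (hb : F.IsMaximalVertex b) {t : ℕ} (ht : Fintype.card V ≤ t) :
    HasLexMap F.graph (fun x y => - L s(x, y)) b t := by
  obtain ⟨φ, hφ⟩ := hb
  have hm := Embedding.isMonotoneMap (H := maxOrdering (Fintype.card V)) hL
    (K := maxLabel _) (fun e e' h => h) φ
  have hinj : Function.Injective fun x => (φ.toCopy x).val :=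
    fun x y h => φ.toCopy.injective (Fin.ext h)
  have hlex : ∀ x y z w, F.graph.Adj x y → F.graph.Adj z w → L s(x, y) < L s(z, w) → _ :=
    fun x y z w hxy hzw hlt => colex_of_maxLabel_lt (hm x y z w hxy hzw hlt)
  have hlt : ∀ x, (φ.toCopy x).val < Fintype.card V := fun x => (φ.toCopy x).2
  generalize hψ : (fun x => (φ.toCopy x).val) = ψ at hinj
  have hψ' : ∀ x, (φ.toCopy x).val = ψ x := fun x => congrFun hψ x
  simp only [hψ'] at hlex hlt hφ
  refine ⟨fun x => Fintype.card V - 1 - ψ x, fun x y h => hinj ?_, fun x => ?_, ?_,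
    fun x y z w hxy hzw h => ?_⟩
  · have := hlt x
    have := hlt y
    simp only at h
    omega
  · have := hlt x
    simp only
    omega
  · simp only
    omega
  · have := hlex z w x y hzw hxy (neg_lt_neg_iff.1 h)
    have := hlt x
    have := hlt y
    have := hlt z
    have := hlt w
    simp only
    omega

/-- The edges at the vertex mapped to 0 precede all others lexicographically. Since `a` has an edge,
the smallest edge at `a` is therefore the smallest edge of `G`. -/
theorem HasLexMap.exists_low {V : Type u} [Finite V] {G : SimpleGraph V} {l : V → V → ℤ} {a : V}
    {t : ℕ} (hl : ∀ x y, l x y = l y x) (h : HasLexMap G l a t) (ha : ¬ G.IsIsolated a) :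
    ∃ w, G.Adj a w ∧ ∀ x y, G.Adj x y → l a w ≤ l x y := by
  obtain ⟨φ, hφ, -, h0, hlex⟩ := h
  simp only [SimpleGraph.IsIsolated, not_forall, not_not] at ha
  obtain ⟨w, hw, hmin⟩ := Set.exists_min_image {w | G.Adj a w} (l a) (Set.toFinite _) ha
  refine ⟨w, hw, fun x y hxy => not_lt.1 fun hlt => ?_⟩
  have := hlex x y a w hxy hw hlt
  rw [h0] at this
  have hxy0 : φ x = φ a ∨ φ y = φ a := by omega
  rcases hxy0 with h | h
  · obtain rfl := hφ h
    exact absurd (hmin y hxy) (not_le.2 hlt)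
  · obtain rfl := hφ h
    exact absurd (hmin x hxy.symm) (not_le.2 (hl x y ▸ hlt))

theorem exists_isSeed {V : Type u} [Fintype V] {F : EdgeOrderedGraph V} {L : Sym2 V → ℤ}
    (hL : ∀ e e' : F.graph.edgeSet, F.EdgeLT e e' ↔ L e.1 < L e'.1) (hF : F.Turanable) {a b : V}
    (ha : F.IsMinimalVertex a) (ha' : ¬ F.graph.IsIsolated a)
    (hb : F.IsMaximalVertex b) (hb' : ¬ F.graph.IsIsolated b) :
    ∃ t, IsSeed F.graph (fun x y => L s(x, y)) a b t := by
  obtain ⟨t, ht⟩ := hF.exists_monotoneMap hL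
  have h1 := ha.hasLexMap hL (le_max_right t (Fintype.card V))
  have h2 := hb.hasLexMap hL (le_max_right t (Fintype.card V))
  refine ⟨max t (Fintype.card V), fun x y z w hxy hzw h => edgeLabel_injOn hL hxy hzw h,
    h1.exists_low (fun x y => by rw [Sym2.eq_swap]) ha', ?_, h1, h2, fun W c hc q hq => ?_⟩
  · obtain ⟨w, hw, h⟩ := h2.exists_low (fun x y => by rw [Sym2.eq_swap]) hb'
    exact ⟨w, hw, fun x y hxy => neg_le_neg_iff.1 (h x y hxy)⟩
  · obtain ⟨φ, h3, h4, h5⟩ := ht W c hc q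
      (fun i j hi hj => hq i j (lt_max_of_lt_left hi) (lt_max_of_lt_left hj))
    exact ⟨φ, h3, fun x => lt_max_of_lt_left (h4 x), h5⟩

theorem IsPendantCopy.exists_embedding {V : Type u} {W : Type} {F : EdgeOrderedGraph V}
    {o : LinearOrder (⊤ : SimpleGraph W).edgeSet} {L : Sym2 V → ℤ} {K : Sym2 W → ℤ}
    (hL : ∀ e e' : F.graph.edgeSet, F.EdgeLT e e' ↔ L e.1 < L e'.1)
    (hK : ∀ e e', (⟨⊤, o⟩ : EdgeOrderedGraph W).EdgeLT e e' ↔ K e.1 < K e'.1) {a b : V}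
    (ha : ¬ F.graph.IsIsolated a) {φ : V → W} {p r : W}
    (h : IsPendantCopy F.graph (fun x y => L s(x, y)) a b (fun x y => K s(x, y)) φ p r) :
    ∃ ψ : Embedding (F.addPendants a b) (⟨⊤, o⟩ : EdgeOrderedGraph W),
      ψ.vertexSet = pendantSupport φ p r := by
  let f : V ⊕ Bool → W := Sum.elim φ (fun i => if i then r else p)
  have hf : Function.Injective f := by
    refine h.inj.sumElim ?_ ?_
    · intro i j hij
      have := h.ne
      cases i <;> cases j <;> simp_all
    · rintro x (_ | _)
      · simpa using h.low_notMem x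
      · simpa using h.high_notMem x
  have hadj : ∃ x y, F.graph.Adj x y := by
    simp only [SimpleGraph.IsIsolated, not_forall, not_not] at ha
    exact ⟨a, ha⟩
  have hlow : ∀ d : F.graph.edgeSet, K ((lowEdge a).map f) < K ((oldEdge d.1).map f) := by
    rintro ⟨d, hd⟩
    induction d using Sym2.ind with
    | _ x y => exact h.low x y hd
  have hhigh : ∀ d : F.graph.edgeSet, K ((oldEdge d.1).map f) < K ((highEdge b).map f) := by
    rintro ⟨d, hd⟩
    induction d using Sym2.ind with
    | _ x y => exact h.high x y hd
  -- A pendant copy compares its two pendant edges only with edges of `F`; some edge of `F`, present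
  -- because `a` is not isolated, links the two comparisons.
  have hlh : K ((lowEdge a).map f) < K ((highEdge b).map f) := by
    obtain ⟨x, y, hxy⟩ := hadj
    exact (hlow ⟨s(x, y), hxy⟩).trans (hhigh ⟨s(x, y), hxy⟩)
  have hold : ∀ d d' : F.graph.edgeSet, F.EdgeLT d d' →
      K ((oldEdge d.1).map f) < K ((oldEdge d'.1).map f) := by
    rintro ⟨d, hd⟩ ⟨d', hd'⟩ hlt
    rw [hL] at hlt
    induction d using Sym2.ind with
    | _ x y =>
    induction d' using Sym2.ind with
    | _ z w => exact h.mono x y z w hd hd' hlt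
  refine ⟨⟨⟨⟨f, fun {x y} hxy => ?_⟩, hf⟩, ?_⟩, ?_⟩
  · exact fun he => hxy.ne (hf he)
  · intro e e' hlt
    rw [hK]
    change K (e.1.map f) < K (e'.1.map f)
    replace hlt : addPendantsLT F a b e e' := hlt
    rcases hlt with ⟨h1, h2⟩ | ⟨h1, h2⟩ | ⟨d, d', hd, h1, h2⟩
    · rw [h1]
      rcases (mem_edgeSet_addPendantsGraph F.graph a b e'.1).1 e'.2 with ⟨d, hd⟩ | hd | hd
      · rw [hd]; exact hlow d
      · exact absurd hd h2
      · rw [hd]; exact hlh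
    · rw [h2]
      rcases (mem_edgeSet_addPendantsGraph F.graph a b e.1).1 e.2 with ⟨d, hd⟩ | hd | hd
      · rw [hd]; exact hhigh d
      · rw [hd]; exact hlh
      · exact absurd hd h1
    · rw [h1, h2]
      exact hold d d' hd
  · change Set.range f = _
    rw [Set.Sum.elim_range, pendantSupport, Set.union_comm, Set.insert_eq, Set.insert_eq,
      ← Set.union_assoc]
    congr 1
    ext w
    simp only [Set.mem_range, Bool.exists_bool, Set.mem_union, Set.mem_singleton_iff]
    simp [eq_comm]

theorem ncard_pendantSupport {V : Type u} [Fintype V] {W : Type} {φ : V → W} {p r : W}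
    (hφ : Function.Injective φ) (hp : ∀ x, φ x ≠ p) (hr : ∀ x, φ x ≠ r) (hpr : p ≠ r) :
    (pendantSupport φ p r).ncard = Fintype.card V + 2 := by
  rw [pendantSupport, Set.ncard_insert_of_notMem, Set.ncard_insert_of_notMem,
    ← Set.image_univ, Set.ncard_image_of_injective _ hφ, Set.ncard_univ, Nat.card_eq_fintype_card]
  · rintro ⟨x, hx⟩
    exact hr x hx
  · rintro (h | ⟨x, hx⟩)
    · exact hpr h
    · exact hp x hx

theorem isLabelling_of_edgeLabel {W : Type} {o : LinearOrder (⊤ : SimpleGraph W).edgeSet}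
    {K : Sym2 W → ℤ}
    (hK : ∀ e e', (⟨⊤, o⟩ : EdgeOrderedGraph W).EdgeLT e e' ↔ K e.1 < K e'.1) :
    IsLabelling (fun x y => K s(x, y)) where
  symm x y := by rw [Sym2.eq_swap]
  inj x y z w hxy hzw h := edgeLabel_injOn hK (e := s(x, y)) (e' := s(z, w)) hxy hzw h

/-- A family of vertex sets of copies which tiles the vertex set gives a perfect tiling. -/
theorem hasPerfectTiling_of_isTiled {V : Type u} {W : Type v} [Fintype W] [DecidableEq W]
    {F : EdgeOrderedGraph V} {H : EdgeOrderedGraph W} {𝓕 : Set (Finset W)}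
    (h𝓕 : ∀ A ∈ 𝓕, ∃ ψ : Embedding F H, ψ.vertexSet = A) (h : IsTiled 𝓕 Finset.univ) :
    H.HasPerfectTiling F := by
  obtain ⟨P, hP, hdisj, hcov⟩ := h
  choose ψ hψ using h𝓕
  refine ⟨{e | ∃ A, ∃ hA : A ∈ P, e = ψ A (hP hA)}, ?_, fun w => ?_⟩
  · rintro _ ⟨A, hA, rfl⟩ _ ⟨B, hB, rfl⟩ hne
    have hAB : A ≠ B := fun h => hne (by subst h; rfl)
    change Disjoint (ψ A _).vertexSet (ψ B _).vertexSet
    rw [hψ A (hP hA), hψ B (hP hB), Finset.disjoint_coe]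
    exact hdisj hA hB hAB
  · obtain ⟨A, hA, hw⟩ := (hcov w).1 (Finset.mem_univ w)
    exact ⟨ψ A (hP hA), ⟨A, hA, rfl⟩, by rw [hψ A (hP hA)]; exact hw⟩

end Translation
end EdgeOrderedGraph

/-! ### Assembly of the theorem -/

open EdgeOrderedGraph in
theorem proposition2p15 {V : Type*} [Fintype V] (F : EdgeOrderedGraph V) (hF : F.Turanable)
    (vmin vmax : V) (hne : vmin ≠ vmax)
    (hmin : F.IsMinimalVertex vmin) (hmin_adj : ¬ F.graph.IsIsolated vmin)
    (hmax : F.IsMaximalVertex vmax) (hmax_adj : ¬ F.graph.IsIsolated vmax) :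
    (F.addPendants vmin vmax).Tileable := by
  classical
  obtain ⟨L, hL⟩ := exists_edgeLabel F
  obtain ⟨m, hseed⟩ := exists_isSeed hL hF hmin hmin_adj hmax hmax_adj
  obtain ⟨M, hM⟩ := hseed.exists_hasCover
  obtain ⟨t, ht, hkt, htile⟩ := exists_isTiled_univ (Fintype.card V + 2) M (by omega)
  refine ⟨t, ht, by simpa using hkt, fun o => ?_⟩
  obtain ⟨K, hK⟩ := exists_edgeLabel (complete t o)
  let 𝓕 : Set (Finset (Fin t)) := {A | ∃ (φ : V → Fin t) (p r : Fin t),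
    IsPendantCopy F.graph (fun x y => L s(x, y)) vmin vmax (fun x y => K s(x, y)) φ p r ∧
      pendantSupport φ p r = A}
  refine hasPerfectTiling_of_isTiled (𝓕 := 𝓕) ?_ (htile 𝓕 ?_ ?_)
  · rintro A ⟨φ, p, r, h, hA⟩
    rw [← hA]
    exact h.exists_embedding hL hK hmin_adj
  · rintro A ⟨φ, p, r, h, hA⟩
    rw [← Set.ncard_coe_finset, ← hA]
    exact ncard_pendantSupport h.inj h.low_notMem h.high_notMem h.ne
  · intro x S hxS hMS
    -- The increasing enumeration of `S`; the default `x` is never reached among the first `M`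
    -- terms, which alone matter.
    let q : ℕ → Fin t := fun i => if h : i < S.card then S.orderEmbOfFin rfl ⟨i, h⟩ else x
    have hq : ∀ i (h : i < M), q i = S.orderEmbOfFin rfl ⟨i, h.trans_le hMS⟩ := fun i h => by
      simp [q, h.trans_le hMS]
    have hqS : ∀ i < M, q i ∈ S := fun i h => by
      rw [hq i h]
      exact S.orderEmbOfFin_mem rfl _
    obtain ⟨φ, p, r, h, hx, hsub⟩ := hM _ (isLabelling_of_edgeLabel hK) q
      (fun i j hi hj hij => by
        rw [hq i hi, hq j hj] at hij
        simpa using (S.orderEmbOfFin rfl).injective hij) x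
      (fun i hi he => hxS (he ▸ hqS i hi))
    have hcoe : ((pendantSupport φ p r).toFinset : Set (Fin t)) = pendantSupport φ p r :=
      Set.coe_toFinset _
    refine ⟨(pendantSupport φ p r).toFinset, ⟨φ, p, r, h, hcoe.symm⟩, by simpa using hx, ?_⟩
    intro w hw
    rcases hsub w (by simpa using hw) with rfl | ⟨i, hi, rfl⟩
    · exact Finset.mem_insert_self _ _
    · exact Finset.mem_insert_of_mem (hqS i hi)
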